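/- Let $X$ be a connected finite CW complex with base point $x_0$, let $\nu\colon \pi_1(X,x_0)\twoheadrightarrow\mathbb{Z}$ be a group epimorphism, let $p$ be a prime number and $r\geq 1$ an integer. Let $X_r\to X$ be the connected $p^r$-fold cyclic covering corresponding to the kernel of the composition $\pi_1(X,x_0)\xrightarrow{\nu}\mathbb{Z}\to\mathbb{Z}/p^r\mathbb{Z}$, and let $\eta_p$ be a singular $1$-cocycle on $X$ with coefficients in $\mathbb{F}_p$ whose class $[\eta_p]\in H^1(X,\mathbb{F}_p)\cong \mathrm{Hom}(\pi_1(X,x_0),\mathbb{F}_p)$ is the composition of $\nu$ with the reduction $\mathbb{Z}\to\mathbb{F}_p$. Write $b_i(Y,\mathbb{F}_p)=\dim_{\mathbb{F}_p}H_i(Y,\mathbb{F}_p)$, and let $$\beta_i(X,\eta_p)=\dim_{\mathbb{F}_p}\frac{\ker\big([\eta_p]\cup-\colon H^i(X,\mathbb{F}_p)\to H^{i+1}(X,\mathbb{F}_p)\big)}{\operatorname{im}\big([\eta_p]\cup-\colon H^{i-1}(X,\mathbb{F}_p)\to H^{i}(X,\mathbb{F}_p)\big)}$$ be the $i$-th Aomoto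 Betti number, i.e. the dimension of the $i$-th cohomology of the complex $(H^*(X,\mathbb{F}_p),[\eta_p]\cup-)$ (with $H^{-1}=0$). Then for every $i\geq 0$, $$b_i(X_r,\mathbb{F}_p)\leq b_i(X,\mathbb{F}_p)+(p^r-1)\cdot\beta_i(X,\eta_p).$$ -/

import Mathlib

universe u

noncomputable section

namespace AomotoCover

/-! ### Cohomology of a sequence of linear maps -/

section Sequence

variable {K : Type*} [Field K] {M : ℕ → Type*} [∀ n, AddCommGroup (M n)] [∀ n, Module K (M n)]

/-- The image in degree `n` of a sequence `M 0 → M 1 → M 2 → ⋯` of linear maps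
(nothing maps to degree `0`). -/
def incoming (d : ∀ n, M n →ₗ[K] M (n + 1)) : ∀ n, Submodule K (M n)
  | 0 => ⊥
  | n + 1 => LinearMap.range (d n)

/-- The cohomology `ker (d n) / im (d (n - 1))` in degree `n` of a cochain complex
`M 0 → M 1 → M 2 → ⋯`. -/
abbrev CohomologyOf (d : ∀ n, M n →ₗ[K] M (n + 1)) (n : ℕ) : Type _ :=
  LinearMap.ker (d n) ⧸ (incoming d n).submoduleOf (LinearMap.ker (d n))

end Sequence

/-! ### Cochains of a simplicial set, cup product -/

section Cochains

open CategoryTheory Simplicial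

variable (K : Type) [Field K] (S : SSet.{u})

/-- `n`-cochains of a simplicial set with coefficients in `K`. -/
abbrev Cochain (n : ℕ) : Type u := S _⦋n⦌ → K

/-- The coboundary `(δ f)(σ) = ∑ i, (-1)^i f(dᵢ σ)`. -/
def coboundary (n : ℕ) : Cochain K S n →ₗ[K] Cochain K S (n + 1) where
  toFun f σ := ∑ i : Fin (n + 2), (-1 : K) ^ (i : ℕ) * f (S.δ i σ)
  map_add' f g := by
    funext σ
    simp [mul_add, Finset.sum_add_distrib]
  map_smul' c f := by
    funext σ
    simp [Finset.mul_sum, mul_left_comm]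

/-- The `n`-th cohomology of a simplicial set with coefficients in `K`. -/
abbrev Cohomology (n : ℕ) : Type u := CohomologyOf (coboundary K S) n

variable {K S}

/-- The cup product of cochains: on an `n`-simplex with vertices `v₀, …, vₙ`, where `a + b = n`,
`(f ∪ g)⟨v₀, …, vₙ⟩ = f⟨v₀, …, vₐ⟩ * g⟨vₐ, …, vₙ⟩`. -/
def cup {a b n : ℕ} (h : a + b = n) (f : Cochain K S a) (g : Cochain K S b) : Cochain K S n :=
  fun σ ↦ f (S.map (SimplexCategory.subinterval 0 a (by omega)).op σ) *
    g (S.map (SimplexCategory.subinterval a b (by omega)).op σ)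

/-- Left cup product with a fixed `1`-cochain. -/
def cupLeft (η : Cochain K S 1) (n : ℕ) : Cochain K S n →ₗ[K] Cochain K S (n + 1) where
  toFun g := cup (Nat.add_comm 1 n) η g
  map_add' f g := by
    funext σ
    simp [cup, mul_add]
  map_smul' c f := by
    funext σ
    simp [cup, mul_left_comm]

/-- The Leibniz rule `δ(η ∪ g) = - η ∪ δ g` for a `1`-cocycle `η`. -/
lemma coboundary_cupLeft (η : Cochain K S 1) (hη : coboundary K S 1 η = 0) (n : ℕ)
    (g : Cochain K S n) :
    coboundary K S (n + 1) (cupLeft η n g) = - cupLeft η (n + 1) (coboundary K S n g) := by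
  funext σ
  have key : ∀ {a b c : ℕ} (f : ⦋a⦌ ⟶ ⦋b⦌) (h : ⦋b⦌ ⟶ ⦋c⦌) (x : S _⦋c⦌),
      S.map f.op (S.map h.op x) = S.map (f ≫ h).op x := by
    intro a b c f h x
    simp
  have f0 : SimplexCategory.subinterval (n := n + 1) 0 1 (by omega) ≫ SimplexCategory.δ 0 =
      SimplexCategory.δ 0 ≫ SimplexCategory.subinterval (n := n + 2) 0 2 (by omega) := by
    ext j
    fin_cases j <;> rfl
  have f1 : SimplexCategory.subinterval (n := n + 1) 0 1 (by omega) ≫ SimplexCategory.δ 1 =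
      SimplexCategory.δ 1 ≫ SimplexCategory.subinterval (n := n + 2) 0 2 (by omega) := by
    ext j
    fin_cases j <;> rfl
  have f2 : SimplexCategory.δ 2 ≫ SimplexCategory.subinterval (n := n + 2) 0 2 (by omega) =
      SimplexCategory.subinterval (n := n + 2) 0 1 (by omega) := by
    ext j
    fin_cases j <;> rfl
  have f3 : ∀ i : Fin (n + 1), SimplexCategory.subinterval (n := n + 1) 0 1 (by omega) ≫
      SimplexCategory.δ i.succ.succ = SimplexCategory.subinterval (n := n + 2) 0 1 (by omega) := by
    intro i
    ext j
    have hj : j.1 < 2 := j.2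
    change (Fin.succAbove i.succ.succ (⟨j.1 + 0, by omega⟩ : Fin (n + 2))).1 = j.1 + 0
    rw [Fin.succAbove_of_castSucc_lt]
    · rfl
    · rw [Fin.lt_def]
      simp only [Fin.val_castSucc, Fin.val_succ]
      omega
  have b0 : SimplexCategory.subinterval (n := n + 1) 1 n (by omega) ≫ SimplexCategory.δ 0 =
      SimplexCategory.δ 0 ≫ SimplexCategory.subinterval (n := n + 2) 1 (n + 1) (by omega) := by
    ext j
    rfl
  have b1 : SimplexCategory.subinterval (n := n + 1) 1 n (by omega) ≫ SimplexCategory.δ 1 =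
      SimplexCategory.δ 0 ≫ SimplexCategory.subinterval (n := n + 2) 1 (n + 1) (by omega) := by
    ext j
    have hj : j.1 < n + 1 := j.2
    change (Fin.succAbove 1 (⟨j.1 + 1, by omega⟩ : Fin (n + 2))).1 = j.1 + 1 + 1
    rw [Fin.succAbove_of_le_castSucc]
    · rfl
    · rw [Fin.le_def]
      simp
  have b2 : ∀ i : Fin (n + 1), SimplexCategory.subinterval (n := n + 1) 1 n (by omega) ≫
      SimplexCategory.δ i.succ.succ =
      SimplexCategory.δ i.succ ≫
        SimplexCategory.subinterval (n := n + 2) 1 (n + 1) (by omega) := by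
    intro i
    ext j
    have hj : j.1 < n + 1 := j.2
    change (Fin.succAbove i.succ.succ (⟨j.1 + 1, by omega⟩ : Fin (n + 2))).1 =
      (Fin.succAbove i.succ (⟨j.1, hj⟩ : Fin (n + 1))).1 + 1
    simp only [Fin.succAbove, Fin.lt_def, Fin.val_castSucc, Fin.val_succ, Nat.add_lt_add_iff_right]
    split_ifs <;> simp
  have hc := congrFun hη (S.map (SimplexCategory.subinterval (n := n + 2) 0 2 (by omega)).op σ)
  simp only [coboundary, LinearMap.coe_mk, AddHom.coe_mk, SimplicialObject.δ, key,
    Pi.zero_apply] at hc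
  rw [Fin.sum_univ_succ, Fin.sum_univ_succ, Fin.sum_univ_one] at hc
  change _ + ((-1 : K) ^ 1 * η (S.map (SimplexCategory.δ 1 ≫
    SimplexCategory.subinterval (n := n + 2) 0 2 (by omega)).op σ) + (-1 : K) ^ 2 * η (S.map (SimplexCategory.δ 2 ≫
    SimplexCategory.subinterval (n := n + 2) 0 2 (by omega)).op σ)) = 0 at hc
  simp only [coboundary, cupLeft, cup, LinearMap.coe_mk, AddHom.coe_mk, Pi.neg_apply,
    SimplicialObject.δ, key]
  rw [Fin.sum_univ_succ, Fin.sum_univ_succ, Fin.sum_univ_succ (n := n + 1)]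
  simp only [Fin.succ_zero_eq_one, f0, f1, f3, b0, b1, b2]
  rw [f2] at hc
  simp only [Fin.val_zero, Fin.val_one, Fin.val_succ, pow_succ, pow_zero] at hc ⊢
  simp only [mul_add, Finset.mul_sum, neg_add, ← Finset.sum_neg_distrib]
  rw [← add_assoc]
  congr 1
  · linear_combination (g (S.map (SimplexCategory.δ 0 ≫
      SimplexCategory.subinterval (n := n + 2) 1 (n + 1) (by omega)).op σ)) * hc
  · refine Finset.sum_congr rfl fun i _ ↦ ?_
    ring

/-- The map `[η] ∪ - : Hⁿ → Hⁿ⁺¹` induced by a `1`-cocycle `η`. -/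
def cupClass (η : LinearMap.ker (coboundary K S 1)) (n : ℕ) :
    Cohomology K S n →ₗ[K] Cohomology K S (n + 1) :=
  Submodule.mapQ _ _
    ((cupLeft η.1 n).restrict (p := LinearMap.ker (coboundary K S n))
      (q := LinearMap.ker (coboundary K S (n + 1))) (by
        intro g hg
        rw [LinearMap.mem_ker] at hg ⊢
        rw [coboundary_cupLeft η.1 η.2, hg, map_zero, neg_zero]))
    (by
      rintro ⟨g, hg⟩ hg'
      rw [Submodule.mem_comap]
      cases n with
      | zero =>
        have h0 : g = 0 := by simpa [Submodule.submoduleOf, incoming] using hg'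
        subst h0
        simp [Submodule.submoduleOf]
      | succ m =>
        obtain ⟨f, rfl⟩ : ∃ f, coboundary K S m f = g := by
          simpa [Submodule.submoduleOf, incoming] using hg'
        refine ⟨-cupLeft η.1 m f, ?_⟩
        rw [map_neg, coboundary_cupLeft η.1 η.2, neg_neg]
        rfl)

/-- The `i`-th Aomoto Betti number: the dimension of the cohomology in degree `i` of the complex
`⋯ → Hⁱ⁻¹ → Hⁱ → Hⁱ⁺¹ → ⋯` with differential the left cup product with the class of the
`1`-cocycle `η`. -/
def aomotoBetti (η : LinearMap.ker (coboundary K S 1)) (i : ℕ) : ℕ∞ :=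
  Cardinal.toENat (Module.rank K (CohomologyOf (cupClass η) i))

end Cochains

/-! ### Topological spaces -/

section Spaces

open CategoryTheory Opposite Simplicial

/-- The `i`-th Betti number of a space with coefficients in `K`: the dimension of its `i`-th
singular homology (an element of `ℕ∞`, so that no junk value is attached to an infinite-dimensional
space; it is finite for a finite CW complex). -/
def betti (K : Type) [Field K] (X : Type u) [TopologicalSpace X] (i : ℕ) : ℕ∞ :=
  Cardinal.toENat (Module.rank K
    (((AlgebraicTopology.singularHomologyFunctor (ModuleCat.{u} K) i).obj
      (ModuleCat.of K (ULift.{u} K))).obj (TopCat.of X)))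

variable {X : Type u} [TopologicalSpace X]

/-- Singular `1`-cocycles of a space. -/
abbrev SingularOneCocycle (K : Type) [Field K] (X : Type u) [TopologicalSpace X] : Type u :=
  LinearMap.ker (coboundary K (TopCat.toSSet.obj (TopCat.of X)) 1)

/-- A path regarded as a singular `1`-simplex: the point with barycentric coordinates
`(1 - t, t)` is sent to `γ t`. -/
def pathSimplex {x y : X} (γ : Path x y) : (TopCat.toSSet.obj (TopCat.of X)) _⦋1⦌ :=
  (TopCat.toSSetObjEquiv (TopCat.of X) (op ⦋1⦌)).symm
    (γ.toContinuousMap.comp ⟨stdSimplexHomeomorphUnitInterval,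
      stdSimplexHomeomorphUnitInterval.continuous⟩)

/-- The singular `1`-cocycle `η` represents the class in `H¹(X, K) = Hom(π₁(X, x₀), K)` given by
the composition of `ν : π₁(X, x₀) → ℤ` with the canonical map `ℤ → K`. -/
def Represents {K : Type} [Field K] {x₀ : X} (η : SingularOneCocycle K X)
    (ν : FundamentalGroup X x₀ →* Multiplicative ℤ) : Prop :=
  ∀ γ : Path x₀ x₀,
    η.1 (pathSimplex γ) = ((ν (FundamentalGroup.fromPath ⟦γ⟧)).toAdd : K)

/-- The reduction of a homomorphism `ν : π₁(X, x₀) → ℤ` modulo `N`. -/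
def reduction {x₀ : X} (ν : FundamentalGroup X x₀ →* Multiplicative ℤ) (N : ℕ) :
    FundamentalGroup X x₀ →* Multiplicative (ZMod N) :=
  (Int.castAddHom (ZMod N)).toMultiplicative.comp ν

/-- `q : (Y, y₀) → (X, x₀)` is the (path-)connected covering space of `X` that corresponds to the
subgroup `H` of `π₁(X, x₀)`, that is, `q` maps `π₁(Y, y₀)` onto `H`. -/
structure IsCoverOf {Y : Type u} [TopologicalSpace Y] {x₀ : X} (H : Subgroup (FundamentalGroup X x₀))
    (q : C(Y, X)) {y₀ : Y} (hq : q y₀ = x₀) : Prop where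
  isCoveringMap : IsCoveringMap q
  pathConnectedSpace : PathConnectedSpace Y
  range_eq : (FundamentalGroup.mapOfEq q hq).range = H

end Spaces

end AomotoCover

end

/-! Over a field, cohomology is dual to homology, so the inequality may be proved for singular
cochains. Unique lifting identifies a simplex of the covering with a simplex of `X` and a level in
`ZMod N`, `N = p ^ r`, attached to its initial vertex. Let `t` be the generator of the covering
group and `ε = t - 1`. In characteristic `p`, `ε ^ N = t ^ N - 1 = 0` and `ε ^ (N - 1) = 1 + t + ⋯ +
t ^ (N - 1)`. Hence the kernel of `ε` is the pullback of the cochains of `X`, and the kernel of `ε ^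
(N - 1)` lies in the image of `ε`.

The subcomplexes `ker ε ^ k` therefore fit into exact sequences `0 → ker ε → ker ε ^ (k + 1) → ker ε
^ k → 0`, the second map being `ε`. Each step adds at most `β` to the dimension in degree `n`.
Multiplying a pulled-back cocycle `z` by the level gives a cochain `θ z` in `ker ε ^ 2` with `ε (θ
z) = z` and coboundary `η ∪ z`. So classes in the image of `[η] ∪ -` die in the cohomology of `ker ε
^ (k + 1)`, and a class of `ker ε` whose image in the cohomology of `ker ε ^ k` lifts along `ε` is
annihilated by `[η] ∪ -`. Counting dimensions (`finrank_le_of_exact`) and inducting from `k = 1` to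
`k = N` gives the factor `N - 1` (`finrank_cohomologyOf_le`).

The topological input is `exists_cyclicCover`: levels can be chosen so that the jump along every
edge reduces to the given cocycle `η` itself, not merely to a cohomologous one. -/

noncomputable section

namespace AomotoCover

/-! ### Subquotients and dimension counts -/

section LinearAlgebra

open Module

variable {K : Type*} [Field K]

/-- The subquotient `Z / (B ∩ Z)` of a vector space. -/
abbrev Subquotient {V : Type*} [AddCommGroup V] [Module K V] (Z B : Submodule K V) : Type _ :=
  Z ⧸ B.submoduleOf Z

/-- The map of subquotients induced by a linear map. -/
def subquotientMap {V W : Type*} [AddCommGroup V] [Module K V] [AddCommGroup W] [Module K W]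
    {Z B : Submodule K V} {Z' B' : Submodule K W} (f : V →ₗ[K] W)
    (hZ : ∀ z ∈ Z, f z ∈ Z') (hB : ∀ b ∈ B, f b ∈ B') :
    Subquotient Z B →ₗ[K] Subquotient Z' B' :=
  Submodule.mapQ _ _ (f.restrict hZ) fun b hb ↦ hB b.1 hb

lemma subquotientMap_mk {V W : Type*} [AddCommGroup V] [Module K V] [AddCommGroup W] [Module K W]
    {Z B : Submodule K V} {Z' B' : Submodule K W} (f : V →ₗ[K] W)
    (hZ : ∀ z ∈ Z, f z ∈ Z') (hB : ∀ b ∈ B, f b ∈ B') (z : Z) :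
    subquotientMap f hZ hB (Submodule.Quotient.mk z) =
      Submodule.Quotient.mk ⟨f z, hZ z z.2⟩ := rfl

lemma subquotient_mk_eq {V : Type*} [AddCommGroup V] [Module K V] {Z B : Submodule K V} (x y : Z) :
    (Submodule.Quotient.mk x : Subquotient Z B) = Submodule.Quotient.mk y ↔ x.1 - y.1 ∈ B := by
  rw [Submodule.Quotient.eq]
  rfl

lemma subquotient_mk_eq_zero {V : Type*} [AddCommGroup V] [Module K V] {Z B : Submodule K V}
    (x : Z) : (Submodule.Quotient.mk x : Subquotient Z B) = 0 ↔ x.1 ∈ B := by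
  rw [Submodule.Quotient.mk_eq_zero]
  rfl

/-- The kernel of `e` lies in the image of `a`, of dimension at most `dim G - dim I`. By `hf`, the
map from `G` to the cokernel of `e` has rank at least that of `f`, so the image of `e` has dimension
at most `dim H' - rank f`. The two bounds add up. -/
lemma finrank_le_of_exact {G H H' L : Type*} [AddCommGroup G] [Module K G] [AddCommGroup H]
    [Module K H] [AddCommGroup H'] [Module K H'] [AddCommGroup L] [Module K L]
    [Module.Finite K G] [Module.Finite K H'] (a : G →ₗ[K] H) (e : H →ₗ[K] H')
    (exact : LinearMap.ker e ≤ LinearMap.range a) (a' : G →ₗ[K] H') (I : Submodule K G)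
    (hI : I ≤ LinearMap.ker a) (f : G →ₗ[K] L)
    (hf : ∀ g, a' g ∈ LinearMap.range e → f g = 0) (β : ℕ)
    (hβ : finrank K G ≤ β + finrank K I + finrank K (LinearMap.range f)) :
    Module.Finite K H ∧ finrank K H ≤ finrank K H' + β := by
  have : Module.Finite K (LinearMap.ker e) :=
    Submodule.finiteDimensional_of_le exact
  have hfin : Module.Finite K H := by
    have : Module.Finite K (H ⧸ LinearMap.ker e) :=
      Module.Finite.equiv e.quotKerEquivRange.symm
    exact Module.Finite.of_submodule_quotient (LinearMap.ker e)
  refine ⟨hfin, ?_⟩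
  have h1 := e.finrank_range_add_finrank_ker
  have h2 := a.finrank_range_add_finrank_ker
  have h3 := f.finrank_range_add_finrank_ker
  have h4 := Submodule.finrank_mono exact
  have h5 := Submodule.finrank_mono hI
  have h6 := ((LinearMap.range e).mkQ ∘ₗ a').finrank_range_add_finrank_ker
  have h7 : LinearMap.ker ((LinearMap.range e).mkQ ∘ₗ a') ≤ LinearMap.ker f := fun g hg ↦ by
    apply hf
    simpa using hg
  have h8 := Submodule.finrank_mono h7
  have h9 := Submodule.finrank_le (LinearMap.range ((LinearMap.range e).mkQ ∘ₗ a'))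
  have h10 := (LinearMap.range e).finrank_quotient_add_finrank
  omega

/-- Since `d ∘ d = 0` is not assumed, only the part of the incoming image inside the kernel is
divided out. This leaves an inequality, in the direction that `finrank_le_of_exact` needs. -/
lemma finrank_le_cohomologyOf {M : ℕ → Type*} [∀ n, AddCommGroup (M n)] [∀ n, Module K (M n)]
    (d : ∀ n, M n →ₗ[K] M (n + 1)) (n : ℕ) [Module.Finite K (M n)] :
    finrank K (M n) ≤ finrank K (CohomologyOf d n) + finrank K (incoming d n) +
      finrank K (LinearMap.range (d n)) := by
  have h1 := (d n).finrank_range_add_finrank_ker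
  have h2 : finrank K (CohomologyOf d n) + _ = _ :=
    ((incoming d n).submoduleOf (LinearMap.ker (d n))).finrank_quotient_add_finrank
  have h3 : finrank K ((incoming d n).submoduleOf (LinearMap.ker (d n))) ≤
      finrank K (incoming d n) := by
    refine LinearMap.finrank_le_finrank_of_injective
      (f := (LinearMap.ker (d n)).subtype.restrict
        (p := (incoming d n).submoduleOf (LinearMap.ker (d n))) (q := incoming d n)
        fun x hx ↦ hx) ?_
    intro x y hxy
    have h := Subtype.ext_iff.mp hxy
    exact Subtype.ext (Subtype.ext h)
  omega

end LinearAlgebra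

/-! ### The filtration by kernels of powers of a nilpotent operator -/

section Filtration

open Module

/-- A cochain complex `V` with an endomorphism `ε`, nilpotent of order `N` and with
`ker ε ^ (N - 1) = im ε`, together with an identification of `ker ε` with a complex `M`, such that
the connecting map of `0 → ker ε → ker ε ^ 2 → ker ε → 0` is represented by `E`. -/
structure NilpotentComplex (K : Type*) [Field K] (N : ℕ) (V M : ℕ → Type*)
    [∀ n, AddCommGroup (V n)] [∀ n, Module K (V n)]
    [∀ n, AddCommGroup (M n)] [∀ n, Module K (M n)] where
  D : ∀ n, V n →ₗ[K] V (n + 1)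
  ε : ∀ n, V n →ₗ[K] V n
  δ : ∀ n, M n →ₗ[K] M (n + 1)
  ι : ∀ n, M n →ₗ[K] V n
  θ : ∀ n, M n →ₗ[K] V n
  E : ∀ n, M n →ₗ[K] M (n + 1)
  D_D : ∀ n v, D (n + 1) (D n v) = 0
  ε_D : ∀ n v, ε (n + 1) (D n v) = D n (ε n v)
  ι_δ : ∀ n z, ι (n + 1) (δ n z) = D n (ι n z)
  ι_injective : ∀ n, Function.Injective (ι n)
  ε_ι : ∀ n z, ε n (ι n z) = 0
  exists_ι : ∀ n v, ε n v = 0 → ∃ z, ι n z = v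
  ε_pow : ∀ n, (ε n) ^ N = 0
  exists_ε : ∀ n v, ((ε n) ^ (N - 1)) v = 0 → ∃ w, ε n w = v
  ε_θ : ∀ n z, ε n (θ n z) = ι n z
  D_θ : ∀ n z, δ n z = 0 → D n (θ n z) = ι (n + 1) (E n z)

namespace NilpotentComplex

variable {K : Type*} [Field K] {N : ℕ} {V M : ℕ → Type*}
    [∀ n, AddCommGroup (V n)] [∀ n, Module K (V n)]
    [∀ n, AddCommGroup (M n)] [∀ n, Module K (M n)] (C : NilpotentComplex K N V M)

/-- The cocycles killed by `ε ^ k`. -/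
def cocycles (k n : ℕ) : Submodule K (V n) :=
  LinearMap.ker (C.D n) ⊓ LinearMap.ker ((C.ε n) ^ k)

/-- The coboundaries of cochains killed by `ε ^ k`. -/
def coboundaries (k : ℕ) : ∀ n, Submodule K (V n)
  | 0 => ⊥
  | n + 1 => (LinearMap.ker ((C.ε n) ^ k)).map (C.D n)

lemma mem_cocycles {k n : ℕ} {v : V n} :
    v ∈ C.cocycles k n ↔ C.D n v = 0 ∧ ((C.ε n) ^ k) v = 0 := by
  simp [cocycles]

lemma ε_pow_succ (k n : ℕ) (v : V n) : ((C.ε n) ^ (k + 1)) v = ((C.ε n) ^ k) (C.ε n v) := by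
  rw [pow_succ]
  rfl

lemma ε_pow_mono {k l n : ℕ} (h : k ≤ l) {v : V n} (hv : ((C.ε n) ^ k) v = 0) :
    ((C.ε n) ^ l) v = 0 := by
  obtain ⟨m, rfl⟩ := Nat.exists_eq_add_of_le' h
  rw [pow_add, Module.End.mul_apply, hv, map_zero]

lemma ε_pow_ι {k n : ℕ} (hk : 1 ≤ k) (z : M n) : ((C.ε n) ^ k) (C.ι n z) = 0 :=
  C.ε_pow_mono hk (by simpa using C.ε_ι n z)

lemma ι_mem_cocycles {k n : ℕ} (hk : 1 ≤ k) (z : M n) (hz : z ∈ LinearMap.ker (C.δ n)) :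
    C.ι n z ∈ C.cocycles k n := by
  rw [mem_cocycles, ← C.ι_δ, LinearMap.mem_ker.mp hz, map_zero]
  exact ⟨rfl, C.ε_pow_ι hk z⟩

lemma ι_mem_coboundaries {k n : ℕ} (hk : 1 ≤ k) (b : M n) (hb : b ∈ incoming C.δ n) :
    C.ι n b ∈ C.coboundaries k n := by
  cases n with
  | zero =>
    have : b = 0 := hb
    simp [this]
  | succ n =>
    obtain ⟨x, rfl⟩ := hb
    rw [C.ι_δ]
    exact ⟨_, C.ε_pow_ι hk x, rfl⟩

lemma ε_mem_cocycles {k n : ℕ} (v : V n) (hv : v ∈ C.cocycles (k + 1) n) :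
    C.ε n v ∈ C.cocycles k n := by
  rw [mem_cocycles, ε_pow_succ] at *
  exact ⟨by rw [← C.ε_D, hv.1, map_zero], hv.2⟩

lemma ε_mem_coboundaries {k n : ℕ} (v : V n) (hv : v ∈ C.coboundaries (k + 1) n) :
    C.ε n v ∈ C.coboundaries k n := by
  cases n with
  | zero =>
    have : v = 0 := hv
    simp [this]
  | succ n =>
    obtain ⟨x, hx, rfl⟩ := hv
    rw [C.ε_D]
    exact ⟨_, by simpa [ε_pow_succ] using hx, rfl⟩

lemma exists_ε_of_pow {k n : ℕ} (hk : k + 1 ≤ N) (v : V n) (hv : ((C.ε n) ^ k) v = 0) :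
    ∃ w, C.ε n w = v ∧ ((C.ε n) ^ (k + 1)) w = 0 := by
  obtain ⟨w, rfl⟩ := C.exists_ε n v (C.ε_pow_mono (by omega) hv)
  exact ⟨w, rfl, by rwa [ε_pow_succ]⟩

/-- For `k < N` the map `ε : ker ε ^ (k + 1) → ker ε ^ k` is onto. Lifting a primitive of `v` and
applying `D`, which commutes with `ε`, lifts `v` to a coboundary. -/
lemma exists_coboundary {k n : ℕ} (hk : k + 1 ≤ N) (v : V n) (hv : v ∈ C.coboundaries k n) :
    ∃ w, C.ε n w = v ∧ w ∈ C.coboundaries (k + 1) n ∧ C.D n w = 0 := by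
  cases n with
  | zero =>
    have : v = 0 := hv
    exact ⟨0, by simp [this], zero_mem _, map_zero _⟩
  | succ n =>
    obtain ⟨x, hx, rfl⟩ := hv
    obtain ⟨w, rfl, hw⟩ := C.exists_ε_of_pow hk x hx
    exact ⟨C.D n w, C.ε_D _ _, ⟨w, hw, rfl⟩, C.D_D _ _⟩

/-- The map from the cohomology of `M` to the cohomology of `ker ε ^ k`. -/
def fromCohomology {k : ℕ} (hk : 1 ≤ k) (n : ℕ) :
    CohomologyOf C.δ n →ₗ[K] Subquotient (C.cocycles k n) (C.coboundaries k n) :=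
  subquotientMap (C.ι n) (C.ι_mem_cocycles hk) (C.ι_mem_coboundaries hk)

/-- The map induced by `ε` from the cohomology of `ker ε ^ (k + 1)` to that of `ker ε ^ k`. -/
def mapε (k n : ℕ) :
    Subquotient (C.cocycles (k + 1) n) (C.coboundaries (k + 1) n) →ₗ[K]
      Subquotient (C.cocycles k n) (C.coboundaries k n) :=
  subquotientMap (C.ε n) C.ε_mem_cocycles C.ε_mem_coboundaries

lemma fromCohomology_one_surjective (n : ℕ) :
    Function.Surjective (C.fromCohomology le_rfl n) := by
  intro x
  induction x using Submodule.Quotient.induction_on with | H x =>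
  obtain ⟨v, hv⟩ := x
  have hv' := C.mem_cocycles.mp hv
  rw [pow_one] at hv'
  obtain ⟨z, rfl⟩ := C.exists_ι n v hv'.2
  have hz : C.δ n z = 0 := by
    apply C.ι_injective
    rw [C.ι_δ, hv'.1, map_zero]
  exact ⟨Submodule.Quotient.mk ⟨z, hz⟩, rfl⟩

/-- Exactness at the middle term of the long exact sequence: if `ε v` is a coboundary, subtracting a
coboundary that lifts it moves `v` into `ker ε`, the image of `ι`. -/
lemma ker_mapε_le {k : ℕ} (hk : 1 ≤ k) (hkN : k + 1 ≤ N) (n : ℕ) :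
    LinearMap.ker (C.mapε k n) ≤ LinearMap.range (C.fromCohomology (k := k + 1) (by omega) n) := by
  intro x hx
  induction x using Submodule.Quotient.induction_on with | H x =>
  obtain ⟨v, hv⟩ := x
  rw [LinearMap.mem_ker, mapε, subquotientMap_mk, subquotient_mk_eq_zero] at hx
  obtain ⟨w, hw, hw', hDw⟩ := C.exists_coboundary hkN _ hx
  obtain ⟨z, hz⟩ := C.exists_ι n (v - w) (by rw [map_sub, hw, sub_self])
  have hδ : C.δ n z = 0 := by
    apply C.ι_injective
    rw [C.ι_δ, hz, map_sub, hDw, (C.mem_cocycles.mp hv).1, sub_self, map_zero]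
  refine ⟨Submodule.Quotient.mk ⟨z, hδ⟩, ?_⟩
  rw [fromCohomology, subquotientMap_mk, subquotient_mk_eq]
  dsimp only
  rw [hz, sub_sub_cancel_left]
  exact neg_mem hw'

variable (F : ∀ n, CohomologyOf C.δ n →ₗ[K] CohomologyOf C.δ (n + 1))

/-- The class of `E x` dies as soon as `k` reaches 2, because `θ x` lies in `ker ε ^ 2` and its
coboundary is `ι (E x)`. -/
lemma incoming_le_ker (hF : ∀ n (z : LinearMap.ker (C.δ n)) (h : C.E n z ∈ LinearMap.ker _),
      F n (Submodule.Quotient.mk z) = Submodule.Quotient.mk ⟨C.E n z, h⟩)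
    {k : ℕ} (hk : 2 ≤ k) (n : ℕ) :
    incoming F n ≤ LinearMap.ker (C.fromCohomology (k := k) (by omega) n) := by
  cases n with
  | zero => exact bot_le
  | succ n =>
    rintro _ ⟨x, rfl⟩
    induction x using Submodule.Quotient.induction_on with | H x =>
    have hE : C.E n x ∈ LinearMap.ker (C.δ (n + 1)) := by
      apply C.ι_injective
      rw [C.ι_δ, ← C.D_θ _ _ x.2, C.D_D, map_zero]
    rw [LinearMap.mem_ker, hF n x hE, fromCohomology, subquotientMap_mk, subquotient_mk_eq_zero]
    dsimp only
    rw [← C.D_θ _ _ x.2]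
    refine ⟨_, C.ε_pow_mono hk ?_, rfl⟩
    rw [ε_pow_succ, C.ε_θ]
    exact C.ε_pow_ι le_rfl _

lemma eq_zero_of_mem_range_mapε
    (hF : ∀ n (z : LinearMap.ker (C.δ n)) (h : C.E n z ∈ LinearMap.ker _),
      F n (Submodule.Quotient.mk z) = Submodule.Quotient.mk ⟨C.E n z, h⟩)
    {k : ℕ} (hk : 1 ≤ k) (hkN : k + 1 ≤ N) (n : ℕ) (g : CohomologyOf C.δ n)
    (hg : C.fromCohomology hk n g ∈ LinearMap.range (C.mapε k n)) : F n g = 0 := by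
  induction g using Submodule.Quotient.induction_on with | H g =>
  obtain ⟨x, hx⟩ := hg
  induction x using Submodule.Quotient.induction_on with | H x =>
  obtain ⟨w, hw⟩ := x
  rw [fromCohomology, mapε, subquotientMap_mk, subquotientMap_mk, subquotient_mk_eq] at hx
  dsimp only at hx
  obtain ⟨b, hb, -, hDb⟩ := C.exists_coboundary hkN _ hx
  have hE : C.E n g ∈ LinearMap.ker (C.δ (n + 1)) := by
    apply C.ι_injective
    rw [C.ι_δ, ← C.D_θ _ _ g.2, C.D_D, map_zero]
  rw [hF n g hE, subquotient_mk_eq_zero]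
  -- Here `ε b = ε w - ι g`, so `ε` kills this combination. As `w` and `b` are cocycles, its
  -- coboundary is that of `θ g`, which exhibits `E g` as `δ m`.
  obtain ⟨m, hm⟩ := C.exists_ι n (C.θ n g - w + b) (by
    rw [map_add, map_sub, hb, C.ε_θ]
    abel)
  refine ⟨m, C.ι_injective _ ?_⟩
  rw [C.ι_δ, hm, map_add, map_sub, hDb, (C.mem_cocycles.mp hw).1, C.D_θ _ _ g.2, sub_zero,
    add_zero]

theorem finrank_subquotient_le
    (hF : ∀ n (z : LinearMap.ker (C.δ n)) (h : C.E n z ∈ LinearMap.ker _),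
      F n (Submodule.Quotient.mk z) = Submodule.Quotient.mk ⟨C.E n z, h⟩)
    (n : ℕ) [Module.Finite K (CohomologyOf C.δ n)] (k : ℕ) (hk : k + 1 ≤ N) :
    Module.Finite K (Subquotient (C.cocycles (k + 1) n) (C.coboundaries (k + 1) n)) ∧
      finrank K (Subquotient (C.cocycles (k + 1) n) (C.coboundaries (k + 1) n)) ≤
        finrank K (CohomologyOf C.δ n) + k * finrank K (CohomologyOf F n) := by
  induction k with
  | zero =>
    have h := C.fromCohomology_one_surjective n
    refine ⟨Module.Finite.of_surjective _ h, ?_⟩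
    simpa using LinearMap.finrank_le_finrank_of_surjective h
  | succ k ih =>
    obtain ⟨h1, h2⟩ := ih (by omega)
    obtain ⟨h3, h4⟩ := finrank_le_of_exact _ _ (C.ker_mapε_le (k := k + 1) (by omega) hk n)
      (C.fromCohomology (by omega) n) (incoming F n) (C.incoming_le_ker F hF (by omega) n) (F n)
      (C.eq_zero_of_mem_range_mapε F hF (by omega) hk n) _ (finrank_le_cohomologyOf F n)
    exact ⟨h3, by linarith⟩

theorem finrank_cohomologyOf_le
    (hF : ∀ n (z : LinearMap.ker (C.δ n)) (h : C.E n z ∈ LinearMap.ker _),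
      F n (Submodule.Quotient.mk z) = Submodule.Quotient.mk ⟨C.E n z, h⟩)
    (hN : N ≠ 0) (n : ℕ) [Module.Finite K (CohomologyOf C.δ n)] :
    Module.Finite K (CohomologyOf C.D n) ∧
      finrank K (CohomologyOf C.D n) ≤
        finrank K (CohomologyOf C.δ n) + (N - 1) * finrank K (CohomologyOf F n) := by
  have h := C.finrank_subquotient_le F hF n (N - 1) (by omega)
  rw [Nat.sub_add_cancel (by omega)] at h
  have h1 : C.cocycles N n = LinearMap.ker (C.D n) := by
    simp [cocycles, C.ε_pow]
  have h2 : C.coboundaries N n = incoming C.D n := by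
    cases n with
    | zero => rfl
    | succ n => simp [coboundaries, incoming, C.ε_pow]
  rwa [h1, h2] at h

end NilpotentComplex

end Filtration

/-! ### Duality between subquotients -/

section Duality

open Module

variable {K : Type*} [Field K]

/-- The restriction map from `Z` to the annihilator of `J` when `Z` is the annihilator of the image
of `J`. -/
def annihilatorRestrict {V W : Type*} [AddCommGroup V] [Module K V]
    [AddCommGroup W] [Module K W] (e : Dual K V ≃ₗ[K] W) (Y : Submodule K V) (J : Submodule K Y)
    (Z : Submodule K W) (hZ : ∀ φ, e φ ∈ Z ↔ ∀ y ∈ J, φ y.1 = 0) : Z →ₗ[K] J.dualAnnihilator :=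
  LinearMap.codRestrict _ (Y.dualRestrict ∘ₗ e.symm.toLinearMap ∘ₗ Z.subtype) fun z ↦ by
    rw [Submodule.mem_dualAnnihilator]
    exact (hZ (e.symm z.1)).mp (by rw [LinearEquiv.apply_symm_apply]; exact z.2)

lemma annihilatorRestrict_apply {V W : Type*} [AddCommGroup V] [Module K V]
    [AddCommGroup W] [Module K W] (e : Dual K V ≃ₗ[K] W) (Y : Submodule K V) (J : Submodule K Y)
    (Z : Submodule K W) (hZ : ∀ φ, e φ ∈ Z ↔ ∀ y ∈ J, φ y.1 = 0) (z : Z) (y : Y) :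
    (annihilatorRestrict e Y J Z hZ z).1 y = e.symm z.1 y.1 := rfl

lemma annihilatorRestrict_surjective {V W : Type*} [AddCommGroup V] [Module K V]
    [AddCommGroup W] [Module K W] (e : Dual K V ≃ₗ[K] W) (Y : Submodule K V) (J : Submodule K Y)
    (Z : Submodule K W) (hZ : ∀ φ, e φ ∈ Z ↔ ∀ y ∈ J, φ y.1 = 0) :
    Function.Surjective (annihilatorRestrict e Y J Z hZ) := by
  rintro ⟨φ, hφ⟩
  have hφJ := (Submodule.mem_dualAnnihilator φ).mp hφ
  obtain ⟨φ', hφ'⟩ := LinearMap.exists_extend φ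
  have h : ∀ y : Y, φ' y = φ y := fun y ↦ LinearMap.congr_fun hφ' y
  refine ⟨⟨e φ', (hZ _).mpr fun y hy ↦ by rw [h, hφJ y hy]⟩, ?_⟩
  refine Subtype.ext (LinearMap.ext fun y ↦ ?_)
  rw [annihilatorRestrict_apply, LinearEquiv.symm_apply_apply]
  exact h y

lemma ker_annihilatorRestrict {V W : Type*} [AddCommGroup V] [Module K V]
    [AddCommGroup W] [Module K W] (e : Dual K V ≃ₗ[K] W) (Y : Submodule K V) (J : Submodule K Y)
    (Z B : Submodule K W) (hZ : ∀ φ, e φ ∈ Z ↔ ∀ y ∈ J, φ y.1 = 0)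
    (hB : ∀ φ, e φ ∈ B ↔ ∀ y ∈ Y, φ y = 0) :
    LinearMap.ker (annihilatorRestrict e Y J Z hZ) = B.submoduleOf Z := by
  ext z
  have h : z ∈ B.submoduleOf Z ↔ e (e.symm z.1) ∈ B := by
    rw [LinearEquiv.apply_symm_apply]
    rfl
  rw [h, hB, LinearMap.mem_ker]
  exact ⟨fun hz y hy ↦ LinearMap.congr_fun (congrArg Subtype.val hz) ⟨y, hy⟩,
    fun hz ↦ Subtype.ext (LinearMap.ext fun y ↦ hz y.1 y.2)⟩

lemma nonempty_quotient_equiv_of_surjective {A U : Type*} [AddCommGroup A] [Module K A]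
    [AddCommGroup U] [Module K U] (f : A →ₗ[K] U) (hf : Function.Surjective f) (P : Submodule K A)
    (hP : LinearMap.ker f = P) : Nonempty ((A ⧸ P) ≃ₗ[K] U) := by
  subst hP
  exact ⟨f.quotKerEquivOfSurjective hf⟩

/-- If `Z` and `B` correspond to the annihilators of `J ≤ Y`, then `Z / B` is dual to `Y / J`. -/
lemma nonempty_subquotient_equiv_dual {V W : Type*} [AddCommGroup V] [Module K V]
    [AddCommGroup W] [Module K W] (e : Dual K V ≃ₗ[K] W) (Y : Submodule K V) (J : Submodule K Y)
    (Z B : Submodule K W) (hZ : ∀ φ, e φ ∈ Z ↔ ∀ y ∈ J, φ y.1 = 0)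
    (hB : ∀ φ, e φ ∈ B ↔ ∀ y ∈ Y, φ y = 0) :
    Nonempty (Subquotient Z B ≃ₗ[K] Dual K (Y ⧸ J)) := by
  apply nonempty_quotient_equiv_of_surjective
    (J.dualQuotEquivDualAnnihilator.symm.toLinearMap ∘ₗ annihilatorRestrict e Y J Z hZ)
  · exact J.dualQuotEquivDualAnnihilator.symm.surjective.comp
      (annihilatorRestrict_surjective e Y J Z hZ)
  · rw [← ker_annihilatorRestrict e Y J Z B hZ hB]
    exact LinearMap.ker_comp_of_ker_eq_bot _ (LinearEquiv.ker _)

/-- The dual of an infinite-dimensional space may have larger dimension, but `Cardinal.toENat` sends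
every infinite cardinal to `⊤`. -/
lemma toENat_rank_dual (V : Type*) [AddCommGroup V] [Module K V] :
    Cardinal.toENat (Module.rank K (Dual K V)) = Cardinal.toENat (Module.rank K V) := by
  by_cases h : Module.Finite K V
  · rw [← finrank_eq_rank, ← finrank_eq_rank, Subspace.dual_finrank_eq]
    simp
  · have h1 : Cardinal.aleph0 ≤ Module.rank K V := by
      rw [← not_lt, Module.rank_lt_aleph0_iff]
      exact h
    have h2 : Cardinal.aleph0 ≤ Module.rank K (Dual K V) := by
      rw [← not_lt, Module.rank_lt_aleph0_iff]
      exact fun h' ↦ h (Module.finite_dual_iff K |>.mp h')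
    rw [Cardinal.toENat_eq_top.mpr h1, Cardinal.toENat_eq_top.mpr h2]

end Duality

/-! ### Cohomology as the dual of homology -/

section UniversalCoefficients

open Module CategoryTheory Limits Simplicial

variable (K : Type) [Field K] (S : SSet.{u})

/-- The chain complex of a simplicial set with coefficients in `K`. -/
abbrev chains : ChainComplex (ModuleCat.{u} K) ℕ :=
  S.chainComplex (ModuleCat.of K (ULift.{u} K))

/-- The chain given by a simplex. -/
def simplexChain {n : ℕ} (x : S _⦋n⦌) : (chains K S).X n :=
  (S.ιChainComplex (R := ModuleCat.of K (ULift.{u} K)) x).hom ⟨1⟩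

variable {S} in
lemma d_simplexChain {n : ℕ} (x : S _⦋n + 1⦌) :
    ((chains K S).d (n + 1) n).hom (simplexChain K S x) =
      ∑ i : Fin (n + 2), (-1 : K) ^ (i : ℕ) • simplexChain K S (S.δ i x) := by
  have h := congrArg (fun f ↦ ModuleCat.Hom.hom f (⟨1⟩ : ULift.{u} K))
    (S.ιChainComplex_d (R := ModuleCat.of K (ULift.{u} K)) x)
  refine h.trans ?_
  rw [ModuleCat.hom_sum, LinearMap.sum_apply]
  refine Finset.sum_congr rfl fun i _ ↦ ?_
  rcases neg_one_pow_eq_or ℤ (i : ℕ) with h | h <;>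
  rcases Nat.even_or_odd (i : ℕ) with h' | h' <;>
  simp [h'.neg_one_pow, simplexChain]

/-- Linear forms on chains are cochains. -/
def evalSimplex (n : ℕ) : Dual K ((chains K S).X n) →ₗ[K] Cochain K S n where
  toFun φ x := φ (simplexChain K S x)
  map_add' _ _ := rfl
  map_smul' _ _ := rfl

lemma evalSimplex_bijective (n : ℕ) : Function.Bijective (evalSimplex K S n) := by
  constructor
  · intro φ ψ h
    have key : ModuleCat.ofHom (ULift.moduleEquiv.symm.toLinearMap ∘ₗ φ :
        (chains K S).X n →ₗ[K] ULift.{u} K) =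
        ModuleCat.ofHom (ULift.moduleEquiv.symm.toLinearMap ∘ₗ ψ) := by
      apply SSet.chainComplex_hom_ext
      intro x
      refine ModuleCat.hom_ext (LinearMap.ext fun c ↦ ?_)
      have hc : c = c.down • (⟨1⟩ : ULift.{u} K) := ULift.ext _ _ (by simp)
      rw [hc, map_smul, map_smul]
      exact congrArg _ (ULift.ext _ _ (congrFun h x))
    ext y
    exact congrArg (fun f ↦ ULift.down (ModuleCat.Hom.hom f y)) key
  · intro f
    let g : (chains K S).X n ⟶ ModuleCat.of K (ULift.{u} K) :=
      Cofan.IsColimit.desc (S.isColimitChainComplexXCofan (ModuleCat.of K (ULift.{u} K)) n)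
        fun x ↦ ModuleCat.ofHom (f x • LinearMap.id)
    have hg : ∀ x, S.ιChainComplex x ≫ g = ModuleCat.ofHom (f x • LinearMap.id) := fun x ↦
      Cofan.IsColimit.fac (S.isColimitChainComplexXCofan (ModuleCat.of K (ULift.{u} K)) n) _ x
    refine ⟨ULift.moduleEquiv.toLinearMap ∘ₗ g.hom, ?_⟩
    funext x
    have h := congrArg (fun f ↦ ModuleCat.Hom.hom f (⟨1⟩ : ULift.{u} K)) (hg x)
    refine (congrArg ULift.down h).trans ?_
    simp

/-- Cochains are the linear forms on chains. -/
def dualChainsEquiv (n : ℕ) : Dual K ((chains K S).X n) ≃ₗ[K] Cochain K S n :=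
  LinearEquiv.ofBijective _ (evalSimplex_bijective K S n)

lemma dualChainsEquiv_d (n : ℕ) (φ : Dual K ((chains K S).X n)) :
    dualChainsEquiv K S (n + 1) (φ ∘ₗ ((chains K S).d (n + 1) n).hom) =
      coboundary K S n (dualChainsEquiv K S n φ) := by
  funext x
  change φ (((chains K S).d (n + 1) n).hom (simplexChain K S x)) = _
  rw [d_simplexChain, map_sum]
  simp only [map_smul, smul_eq_mul]
  rfl

lemma coboundary_coboundary (n : ℕ) (f : Cochain K S n) :
    coboundary K S (n + 1) (coboundary K S n f) = 0 := by
  obtain ⟨φ, rfl⟩ := (dualChainsEquiv K S n).surjective f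
  rw [← dualChainsEquiv_d, ← dualChainsEquiv_d, LinearMap.comp_assoc, ← ModuleCat.hom_comp,
    HomologicalComplex.d_comp_d]
  simp

lemma dualChainsEquiv_mem_ker_iff (n : ℕ) (φ : Dual K ((chains K S).X n)) :
    dualChainsEquiv K S n φ ∈ LinearMap.ker (coboundary K S n) ↔
      ∀ y, φ (((chains K S).d (n + 1) n).hom y) = 0 := by
  rw [LinearMap.mem_ker, ← dualChainsEquiv_d, LinearEquiv.map_eq_zero_iff, LinearMap.ext_iff]
  rfl

lemma dualChainsEquiv_mem_incoming_iff (n : ℕ) (φ : Dual K ((chains K S).X n)) :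
    dualChainsEquiv K S n φ ∈ incoming (coboundary K S) n ↔
      ∀ y ∈ LinearMap.ker ((chains K S).d n (n - 1)).hom, φ y = 0 := by
  cases n with
  | zero =>
    -- In degree 0 the index `n - 1` truncates to 0 and `d 0 0` vanishes. Its kernel is everything,
    -- with annihilator 0.
    rw [show incoming (coboundary K S) 0 = ⊥ from rfl, Submodule.mem_bot,
      LinearEquiv.map_eq_zero_iff, HomologicalComplex.shape _ _ _ (by simp)]
    simp [LinearMap.ext_iff]
  | succ n =>
    have h1 : φ ∈ LinearMap.range ((chains K S).d (n + 1) n).hom.dualMap ↔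
        ∀ y ∈ LinearMap.ker ((chains K S).d (n + 1) n).hom, φ y = 0 := by
      rw [LinearMap.range_dualMap_eq_dualAnnihilator_ker, Submodule.mem_dualAnnihilator]
    rw [Nat.add_sub_cancel, ← h1]
    constructor
    · rintro ⟨g, hg⟩
      obtain ⟨ψ, rfl⟩ := (dualChainsEquiv K S n).surjective g
      rw [← dualChainsEquiv_d] at hg
      exact ⟨ψ, (dualChainsEquiv K S (n + 1)).injective hg⟩
    · rintro ⟨ψ, rfl⟩
      exact ⟨dualChainsEquiv K S n ψ, (dualChainsEquiv_d K S n ψ).symm⟩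

/-- Cocycles are the forms that vanish on boundaries, and coboundaries those that vanish on cycles.
Their quotient is thus dual to cycles modulo boundaries. -/
theorem betti_eq (X : Type u) [TopologicalSpace X] (i : ℕ) :
    betti K X i =
      Cardinal.toENat (Module.rank K (Cohomology K (TopCat.toSSet.obj (TopCat.of X)) i)) := by
  set S := TopCat.toSSet.obj (TopCat.of X)
  have hnext : (ComplexShape.down ℕ).next i = i - 1 := by
    cases i <;> simp
  let S' := (chains K S).sc' (i + 1) i (i - 1)
  have e1 : (chains K S).homology i ≅ ModuleCat.of K
      (LinearMap.ker S'.g.hom ⧸ LinearMap.range S'.moduleCatToCycles) :=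
    ShortComplex.homologyMapIso ((chains K S).isoSc' (i + 1) i (i - 1) (by simp) hnext) ≪≫
      S'.moduleCatHomologyIso
  obtain ⟨e2⟩ := nonempty_subquotient_equiv_dual (dualChainsEquiv K S i) (LinearMap.ker S'.g.hom)
    (LinearMap.range S'.moduleCatToCycles) (LinearMap.ker (coboundary K S i))
    (incoming (coboundary K S) i)
    (fun φ ↦ by
      rw [dualChainsEquiv_mem_ker_iff]
      constructor
      · rintro h _ ⟨y, rfl⟩
        exact h y
      · intro h y
        exact h _ ⟨y, rfl⟩)
    (dualChainsEquiv_mem_incoming_iff K S i)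
  have h1 : betti K X i = Cardinal.toENat (Module.rank K ((chains K S).homology i)) := rfl
  rw [h1, e1.toLinearEquiv.rank_eq, e2.rank_eq, toENat_rank_dual]
  rfl

end UniversalCoefficients

/-! ### Cochains of a cyclic covering of simplicial sets -/

section CyclicCover

open CategoryTheory Simplicial Opposite

/-- The initial vertex of a simplex. -/
def initialVertex {S : SSet.{u}} {n : ℕ} (s : S _⦋n⦌) : S _⦋0⦌ :=
  S.map (SimplexCategory.const ⦋0⦌ ⦋n⦌ 0).op s

/-- The edge of a simplex that joins its first two vertices. -/
def initialEdge {S : SSet.{u}} {n : ℕ} (s : S _⦋n + 1⦌) : S _⦋1⦌ :=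
  S.map (SimplexCategory.subinterval 0 1 (by omega)).op s

lemma map_op_map_op {S : SSet.{u}} {a b c : ℕ} (f : ⦋a⦌ ⟶ ⦋b⦌) (h : ⦋b⦌ ⟶ ⦋c⦌) (x : S _⦋c⦌) :
    S.map f.op (S.map h.op x) = S.map (f ≫ h).op x := by
  simp

lemma initialVertex_δ_succ {S : SSet.{u}} {n : ℕ} (s : S _⦋n + 1⦌) (i : Fin (n + 1)) :
    initialVertex (S.δ i.succ s) = initialVertex s := by
  unfold initialVertex SimplicialObject.δ
  rw [map_op_map_op, SimplexCategory.const_comp]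
  congr 2

lemma initialVertex_δ_zero {S : SSet.{u}} {n : ℕ} (s : S _⦋n + 1⦌) :
    initialVertex (S.δ 0 s) = S.δ 0 (initialEdge s) := by
  unfold initialVertex initialEdge SimplicialObject.δ
  rw [map_op_map_op, map_op_map_op]
  congr 3
  exact congrArg Quiver.Hom.op (SimplexCategory.Hom.ext_zero_left _ _ rfl)

lemma initialVertex_eq_δ_one {S : SSet.{u}} {n : ℕ} (s : S _⦋n + 1⦌) :
    initialVertex s = S.δ 1 (initialEdge s) := by
  unfold initialVertex initialEdge SimplicialObject.δ
  rw [map_op_map_op]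
  congr 3
  exact congrArg Quiver.Hom.op (SimplexCategory.Hom.ext_zero_left _ _ rfl)

lemma initialEdge_naturality {S' S : SSet.{u}} (π : S' ⟶ S) {n : ℕ} (s : S' _⦋n + 1⦌) :
    π.app _ (initialEdge s) = initialEdge (π.app _ s) :=
  NatTrans.naturality_apply π _ s

section

variable (K : Type) [Field K]

lemma sub_one_pow_eq_zero {A : Type*} [Ring A] [Algebra K A] (p r : ℕ) [Fact p.Prime] [CharP K p]
    (a : A) (ha : a ^ p ^ r = 1) : (a - 1) ^ p ^ r = 0 := by
  have h : (Polynomial.X - 1 : Polynomial K) ^ p ^ r = Polynomial.X ^ p ^ r - 1 := by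
    rw [sub_pow_char_pow, one_pow]
  simpa [ha] using congrArg (Polynomial.aeval a) h

/-- In `K[X]`, `(X - 1) ^ p ^ r = X ^ p ^ r - 1` is `X - 1` times the geometric sum. Cancel `X - 1`
and evaluate at `a`. -/
lemma sub_one_pow_eq_sum {A : Type*} [Ring A] [Algebra K A] (p r : ℕ) [Fact p.Prime] [CharP K p]
    (a : A) : (a - 1) ^ (p ^ r - 1) = ∑ j ∈ Finset.range (p ^ r), a ^ j := by
  have hp : p ^ r ≠ 0 := pow_ne_zero _ (Fact.out : p.Prime).ne_zero
  have h : (Polynomial.X - 1 : Polynomial K) ^ (p ^ r - 1) =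
      ∑ j ∈ Finset.range (p ^ r), Polynomial.X ^ j := by
    have h1 : (Polynomial.X - 1 : Polynomial K) ≠ 0 := by
      simpa using Polynomial.X_sub_C_ne_zero (1 : K)
    apply mul_left_cancel₀ h1
    rw [mul_geom_sum, ← pow_succ', Nat.sub_add_cancel (Nat.one_le_iff_ne_zero.mpr hp),
      sub_pow_char_pow, one_pow]
  simpa using congrArg (Polynomial.aeval a) h

lemma coboundary_apply {T : SSet.{u}} {n : ℕ} (f : Cochain K T n) (s : T _⦋n + 1⦌) :
    coboundary K T n f s = ∑ i : Fin (n + 2), (-1 : K) ^ (i : ℕ) * f (T.δ i s) := rfl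

lemma cupLeft_apply {T : SSet.{u}} {n : ℕ} (η : Cochain K T 1) (z : Cochain K T n)
    (s : T _⦋n + 1⦌) : cupLeft η n z s = η (initialEdge s) * z (T.δ 0 s) := by
  have h : SimplexCategory.subinterval (n := n + 1) 1 n (by omega) = SimplexCategory.δ 0 := by
    ext j
    rfl
  change η _ * z (T.map (SimplexCategory.subinterval (n := n + 1) 1 n (by omega)).op s) = _
  rw [h]
  rfl

end

lemma toENat_rank_eq_finrank {K V : Type*} [Field K] [AddCommGroup V] [Module K V]
    (h : Module.Finite K V) : Cardinal.toENat (Module.rank K V) = Module.finrank K V := by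
  rw [← Module.finrank_eq_rank, Cardinal.toENat_nat]

/-- A cyclic covering of simplicial sets, trivialized by a numbering `level` of the vertices. -/
structure CyclicCover (N : ℕ) (S' S : SSet.{u}) where
  π : S' ⟶ S
  level : S' _⦋0⦌ → ZMod N
  jump : S _⦋1⦌ → ZMod N
  level_edge : ∀ s : S' _⦋1⦌, level (S'.δ 0 s) = level (S'.δ 1 s) + jump (π.app _ s)
  bijective : ∀ n, Function.Bijective
    fun s : S' _⦋n⦌ ↦ ((π.app _ s, level (initialVertex s)) : S _⦋n⦌ × ZMod N)

namespace CyclicCover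

variable {N : ℕ} {S' S : SSet.{u}} (C : CyclicCover N S' S)

/-- A simplex of the covering is given by its image and its level. -/
def equiv (n : ℕ) : S' _⦋n⦌ ≃ S _⦋n⦌ × ZMod N := Equiv.ofBijective _ (C.bijective n)

/-- The level of a simplex. -/
def simplexLevel {n : ℕ} (s : S' _⦋n⦌) : ZMod N := C.level (initialVertex s)

lemma π_equiv_symm {n : ℕ} (x : S _⦋n⦌ × ZMod N) : C.π.app _ ((C.equiv n).symm x) = x.1 :=
  congrArg Prod.fst ((C.equiv n).apply_symm_apply x)

lemma simplexLevel_equiv_symm {n : ℕ} (x : S _⦋n⦌ × ZMod N) :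
    C.simplexLevel ((C.equiv n).symm x) = x.2 :=
  congrArg Prod.snd ((C.equiv n).apply_symm_apply x)

/-- The translation of simplices along the fibers. -/
def translate {n : ℕ} (g : ZMod N) (s : S' _⦋n⦌) : S' _⦋n⦌ :=
  (C.equiv n).symm (C.π.app _ s, C.simplexLevel s + g)

@[simp] lemma π_translate {n : ℕ} (g : ZMod N) (s : S' _⦋n⦌) :
    C.π.app _ (C.translate g s) = C.π.app _ s := C.π_equiv_symm _

@[simp] lemma simplexLevel_translate {n : ℕ} (g : ZMod N) (s : S' _⦋n⦌) :
    C.simplexLevel (C.translate g s) = C.simplexLevel s + g := C.simplexLevel_equiv_symm _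

lemma ext_simplex {n : ℕ} {s t : S' _⦋n⦌} (h : C.π.app _ s = C.π.app _ t)
    (h' : C.simplexLevel s = C.simplexLevel t) : s = t :=
  (C.equiv n).injective (Prod.ext h h')

lemma translate_translate {n : ℕ} (g g' : ZMod N) (s : S' _⦋n⦌) :
    C.translate g (C.translate g' s) = C.translate (g' + g) s :=
  C.ext_simplex (by simp) (by simp [add_assoc])

lemma translate_zero {n : ℕ} (s : S' _⦋n⦌) : C.translate 0 s = s :=
  C.ext_simplex (by simp) (by simp)

lemma simplexLevel_δ_zero {n : ℕ} (s : S' _⦋n + 1⦌) :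
    C.simplexLevel (S'.δ 0 s) = C.simplexLevel s + C.jump (initialEdge (C.π.app _ s)) := by
  rw [simplexLevel, simplexLevel, initialVertex_δ_zero, initialVertex_eq_δ_one, C.level_edge,
    initialEdge_naturality]

lemma simplexLevel_δ_succ {n : ℕ} (s : S' _⦋n + 1⦌) (i : Fin (n + 1)) :
    C.simplexLevel (S'.δ i.succ s) = C.simplexLevel s := by
  rw [simplexLevel, simplexLevel, initialVertex_δ_succ]

lemma π_δ {n : ℕ} (s : S' _⦋n + 1⦌) (i : Fin (n + 2)) :
    C.π.app _ (S'.δ i s) = S.δ i (C.π.app _ s) := NatTrans.naturality_apply C.π _ s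

/-- Only the zeroth face changes the initial vertex, and the resulting jump depends only on the
image in `S`. Translation thus commutes with all faces. -/
lemma δ_translate {n : ℕ} (g : ZMod N) (s : S' _⦋n + 1⦌) (i : Fin (n + 2)) :
    S'.δ i (C.translate g s) = C.translate g (S'.δ i s) := by
  apply C.ext_simplex
  · rw [π_δ, π_translate, π_translate, π_δ]
  · rw [simplexLevel_translate]
    induction i using Fin.cases with
    | zero =>
      rw [simplexLevel_δ_zero, simplexLevel_δ_zero, simplexLevel_translate, π_translate]
      abel
    | succ i => rw [simplexLevel_δ_succ, simplexLevel_δ_succ, simplexLevel_translate]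

section Cochains

variable (K : Type) [Field K]

/-- The action of the generator of the covering group on cochains. -/
def shift (n : ℕ) : Module.End K (Cochain K S' n) := LinearMap.funLeft K K (C.translate 1)

lemma shift_apply {n : ℕ} (f : Cochain K S' n) (s : S' _⦋n⦌) :
    C.shift K n f s = f (C.translate 1 s) := rfl

lemma shift_pow_apply {n : ℕ} (j : ℕ) (f : Cochain K S' n) (s : S' _⦋n⦌) :
    (C.shift K n ^ j) f s = f (C.translate j s) := by
  induction j generalizing s with
  | zero => simp [translate_zero]
  | succ j ih =>
    rw [pow_succ', Module.End.mul_apply, shift_apply, ih, translate_translate]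
    push_cast
    rw [add_comm]

lemma shift_pow_eq_one (n : ℕ) : C.shift K n ^ N = 1 := by
  refine LinearMap.ext fun f ↦ funext fun s ↦ ?_
  rw [shift_pow_apply]
  simp [translate_zero]

/-- The pullback of cochains. -/
def pullback (n : ℕ) : Cochain K S n →ₗ[K] Cochain K S' n :=
  LinearMap.funLeft K K fun s ↦ C.π.app _ s

lemma pullback_apply {n : ℕ} (z : Cochain K S n) (s : S' _⦋n⦌) :
    C.pullback K n z s = z (C.π.app _ s) := rfl

/-- The pullback of cochains, multiplied by the level. -/
def levelPullback (φ : ZMod N →+* K) (n : ℕ) : Cochain K S n →ₗ[K] Cochain K S' n where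
  toFun z s := φ (C.simplexLevel s) * z (C.π.app _ s)
  map_add' _ _ := funext fun _ ↦ mul_add _ _ _
  map_smul' _ _ := funext fun _ ↦ mul_left_comm _ _ _

lemma levelPullback_apply (φ : ZMod N →+* K) {n : ℕ} (z : Cochain K S n) (s : S' _⦋n⦌) :
    C.levelPullback K φ n z s = φ (C.simplexLevel s) * z (C.π.app _ s) := rfl

/-- All faces but the zeroth keep the level, so the coboundary is the level times the pullback of `δ
z`, which vanishes, plus the jump on the initial edge times the value on the zeroth face. The latter
is the cup product. -/
lemma coboundary_levelPullback (φ : ZMod N →+* K) {n : ℕ} (z : Cochain K S n)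
    (η : Cochain K S 1) (hη : ∀ x, η x = φ (C.jump x)) (hz : coboundary K S n z = 0) :
    coboundary K S' n (C.levelPullback K φ n z) = C.pullback K (n + 1) (cupLeft η n z) := by
  funext s
  have h := congrFun hz (C.π.app _ s)
  rw [coboundary_apply, Fin.sum_univ_succ] at h
  rw [coboundary_apply, Fin.sum_univ_succ, pullback_apply, cupLeft_apply]
  simp only [levelPullback_apply, simplexLevel_δ_zero, simplexLevel_δ_succ, π_δ, map_add,
    hη, Fin.val_zero, pow_zero, one_mul, mul_left_comm _ (φ _)] at h ⊢
  rw [← Finset.mul_sum]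
  rw [Pi.zero_apply] at h
  linear_combination φ (C.simplexLevel s) * h

lemma exists_shift_sub_one [NeZero N] {n : ℕ} (f : Cochain K S' n)
    (hf : ∀ s, ∑ j ∈ Finset.range N, f (C.translate j s) = 0) :
    ∃ w, (C.shift K n - 1) w = f := by
  let F (s : S' _⦋n⦌) (j : ℕ) : K := f ((C.equiv n).symm (C.π.app _ s, j))
  have hF : ∀ s, ∑ j ∈ Finset.range N, F s j = 0 := fun s ↦ by
    rw [← hf ((C.equiv n).symm (C.π.app _ s, 0))]
    refine Finset.sum_congr rfl fun j _ ↦ ?_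
    simp [F, translate, π_equiv_symm, simplexLevel_equiv_symm]
  -- The primitive is the partial sum of `f` along the fiber over levels below that of `s`. The
  -- vanishing of the full sum handles the wrap from level `N - 1` to `0`.
  refine ⟨fun s ↦ ∑ j ∈ Finset.range (C.simplexLevel s).val, F s j, funext fun s ↦ ?_⟩
  have hs : F s (C.simplexLevel s).val = f s := by
    simp only [F, ZMod.natCast_zmod_val]
    congr 1
    exact C.ext_simplex (C.π_equiv_symm _) (C.simplexLevel_equiv_symm _)
  rw [LinearMap.sub_apply, Pi.sub_apply, shift_apply, Module.End.one_apply,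
    simplexLevel_translate, sub_eq_iff_eq_add', ← hs, ← Finset.sum_range_succ]
  have hFt : F (C.translate 1 s) = F s := by
    simp [F]
  rw [hFt]
  have hlt := ZMod.val_lt (C.simplexLevel s)
  have hval : (C.simplexLevel s + 1).val = ((C.simplexLevel s).val + 1) % N := by
    rw [← ZMod.val_natCast, Nat.cast_add, ZMod.natCast_zmod_val, Nat.cast_one]
  rw [hval]
  rcases Nat.lt_or_eq_of_le (Nat.succ_le_of_lt hlt) with h | h
  · rw [Nat.mod_eq_of_lt h]
  · rw [show (C.simplexLevel s).val + 1 = N from h, Nat.mod_self, Finset.range_zero,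
      Finset.sum_empty, hF]

lemma pullback_injective (n : ℕ) : Function.Injective (C.pullback K n) := fun z w h ↦ by
  funext x
  have := congrFun h ((C.equiv n).symm (x, 0))
  rwa [pullback_apply, pullback_apply, π_equiv_symm] at this

lemma shift_sub_one_apply {n : ℕ} (f : Cochain K S' n) (s : S' _⦋n⦌) :
    (C.shift K n - 1) f s = f (C.translate 1 s) - f s := rfl

lemma exists_pullback {n : ℕ} [NeZero N] (f : Cochain K S' n) (hf : (C.shift K n - 1) f = 0) :
    ∃ z, C.pullback K n z = f := by
  have h1 : C.shift K n f = f := by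
    rwa [LinearMap.sub_apply, sub_eq_zero] at hf
  have h2 : ∀ j : ℕ, (C.shift K n ^ j) f = f := fun j ↦ by
    induction j with
    | zero => rfl
    | succ j ih => rw [pow_succ, Module.End.mul_apply, h1, ih]
  refine ⟨fun x ↦ f ((C.equiv n).symm (x, 0)), funext fun s ↦ ?_⟩
  rw [pullback_apply, ← h2 (C.simplexLevel s).val, shift_pow_apply, h2]
  congr 1
  exact C.ext_simplex (by simp [π_equiv_symm]) (by simp [simplexLevel_equiv_symm])

lemma coboundary_pullback {n : ℕ} (z : Cochain K S n) :
    C.pullback K (n + 1) (coboundary K S n z) = coboundary K S' n (C.pullback K n z) := by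
  funext s
  simp only [pullback_apply, coboundary_apply, π_δ]

lemma shift_coboundary {n : ℕ} (f : Cochain K S' n) :
    (C.shift K (n + 1) - 1) (coboundary K S' n f) =
      coboundary K S' n ((C.shift K n - 1) f) := by
  funext s
  simp only [shift_sub_one_apply, coboundary_apply, δ_translate, mul_sub, Finset.sum_sub_distrib]

/-- The cochains of a cyclic covering of prime power degree, with the nilpotent operator given by
the generator of the covering group minus the identity. -/
def nilpotentComplex (p r : ℕ) [Fact p.Prime] [CharP K p] (C : CyclicCover (p ^ r) S' S)
    (φ : ZMod (p ^ r) →+* K) (η : Cochain K S 1) (hη : ∀ x, η x = φ (C.jump x)) :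
    NilpotentComplex K (p ^ r) (Cochain K S') (Cochain K S) where
  D := coboundary K S'
  ε n := C.shift K n - 1
  δ := coboundary K S
  ι := C.pullback K
  θ := C.levelPullback K φ
  E := cupLeft η
  D_D := coboundary_coboundary K S'
  ε_D _ := C.shift_coboundary K
  ι_δ _ := C.coboundary_pullback K
  ι_injective := C.pullback_injective K
  ε_ι n z := by
    funext s
    rw [shift_sub_one_apply, pullback_apply, pullback_apply, π_translate, sub_self]
    rfl
  exists_ι _ := C.exists_pullback K
  ε_pow n := sub_one_pow_eq_zero K p r _ (C.shift_pow_eq_one K n)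
  exists_ε n f hf := by
    refine C.exists_shift_sub_one K f fun s ↦ ?_
    rw [sub_one_pow_eq_sum K p r] at hf
    simpa [LinearMap.sum_apply, shift_pow_apply] using congrFun hf s
  ε_θ n z := by
    funext s
    rw [shift_sub_one_apply, levelPullback_apply, levelPullback_apply, π_translate,
      simplexLevel_translate, map_add, map_one, pullback_apply]
    ring
  D_θ _ z := C.coboundary_levelPullback K φ z η hη

end Cochains

theorem toENat_rank_cohomology_le (K : Type) [Field K] (p r : ℕ) [Fact p.Prime] [CharP K p]
    (C : CyclicCover (p ^ r) S' S) (φ : ZMod (p ^ r) →+* K)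
    (η : LinearMap.ker (coboundary K S 1)) (hη : ∀ x, η.1 x = φ (C.jump x)) (i : ℕ) :
    Cardinal.toENat (Module.rank K (Cohomology K S' i)) ≤
      Cardinal.toENat (Module.rank K (Cohomology K S i)) +
        ((p ^ r - 1 : ℕ) : ℕ∞) * aomotoBetti η i := by
  by_cases hfin : Module.Finite K (Cohomology K S i)
  · have : Module.Finite K (CohomologyOf (nilpotentComplex K p r C φ η.1 hη).δ i) := hfin
    obtain ⟨h1, h2⟩ := NilpotentComplex.finrank_cohomologyOf_le
      (nilpotentComplex K p r C φ η.1 hη) (cupClass η) (fun n z h ↦ rfl)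
      (pow_ne_zero _ (Fact.out : p.Prime).ne_zero) i
    have h3 : Module.Finite K (CohomologyOf (cupClass η) i) := inferInstance
    refine (toENat_rank_eq_finrank h1).trans_le ?_
    rw [aomotoBetti, toENat_rank_eq_finrank hfin, toENat_rank_eq_finrank h3]
    exact_mod_cast h2
  · have h : Cardinal.aleph0 ≤ Module.rank K (Cohomology K S i) := by
      rw [← not_lt, Module.rank_lt_aleph0_iff]
      exact hfin
    rw [Cardinal.toENat_eq_top.mpr h, top_add]
    exact le_top

end CyclicCover

end CyclicCover

/-! ### Extension of `ν` from loops to paths -/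

section Monodromy

open Path

variable {X : Type*} [TopologicalSpace X] {x₀ : X}

/-- The value of `ν` on the class of a loop. -/
def loopDegree (ν : FundamentalGroup X x₀ →* Multiplicative ℤ) (γ : Homotopic.Quotient x₀ x₀) : ℤ :=
  (ν (FundamentalGroup.fromPath γ)).toAdd

lemma loopDegree_trans (ν : FundamentalGroup X x₀ →* Multiplicative ℤ)
    (γ γ' : Homotopic.Quotient x₀ x₀) :
    loopDegree ν (γ.trans γ') = loopDegree ν γ + loopDegree ν γ' := by
  -- The group multiplies loops in the order opposite to concatenation. This is harmless because the
  -- target is commutative.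
  have h : FundamentalGroup.fromPath (γ.trans γ') =
    FundamentalGroup.fromPath γ' * FundamentalGroup.fromPath γ := rfl
  rw [loopDegree, h, map_mul, toAdd_mul, add_comm]
  rfl

/-- The extension of `ν` to paths, by means of paths `α x` from the base point to `x`. -/
def pathDegree (ν : FundamentalGroup X x₀ →* Multiplicative ℤ) (α : ∀ x, Homotopic.Quotient x₀ x)
    {x y : X}
    (γ : Homotopic.Quotient x y) : ℤ :=
  loopDegree ν ((α x).trans (γ.trans (α y).symm))

variable (ν : FundamentalGroup X x₀ →* Multiplicative ℤ) (α : ∀ x, Homotopic.Quotient x₀ x)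

lemma pathDegree_trans {x y z : X} (γ : Homotopic.Quotient x y) (γ' : Homotopic.Quotient y z) :
    pathDegree ν α (γ.trans γ') = pathDegree ν α γ + pathDegree ν α γ' := by
  rw [pathDegree, pathDegree, pathDegree, ← loopDegree_trans]
  congr 1
  simp only [Homotopic.Quotient.trans_assoc]
  rw [← Homotopic.Quotient.trans_assoc (α y).symm, Homotopic.Quotient.symm_trans, Homotopic.Quotient.refl_trans]

lemma pathDegree_refl (x : X) : pathDegree ν α (Homotopic.Quotient.refl x) = 0 := by
  have h := pathDegree_trans ν α (Homotopic.Quotient.refl x) (Homotopic.Quotient.refl x)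
  rw [Homotopic.Quotient.refl_trans] at h
  omega

lemma pathDegree_symm {x y : X} (γ : Homotopic.Quotient x y) :
    pathDegree ν α γ.symm = - pathDegree ν α γ := by
  have h := pathDegree_trans ν α γ γ.symm
  rw [Homotopic.Quotient.trans_symm, pathDegree_refl] at h
  omega

/-- The chosen loop `α x₀` need not be trivial. Its degree and that of its inverse cancel. -/
lemma pathDegree_loop (γ : Homotopic.Quotient x₀ x₀) : pathDegree ν α γ = loopDegree ν γ := by
  have h := pathDegree_refl ν α x₀
  rw [pathDegree, loopDegree_trans, Homotopic.Quotient.refl_trans] at h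
  rw [pathDegree, loopDegree_trans, loopDegree_trans]
  omega

lemma pathDegree_cast {x y x' y' : X} (γ : Homotopic.Quotient x y) (hx : x' = x) (hy : y' = y) :
    pathDegree ν α (γ.cast hx hy) = pathDegree ν α γ := by
  subst hx hy
  rw [Homotopic.Quotient.cast_rfl_rfl]

lemma exists_pathDegree_eq (hν : Function.Surjective ν) (x : X) (d : ℤ) :
    ∃ γ : Homotopic.Quotient x₀ x, pathDegree ν α γ = d := by
  obtain ⟨g, hg⟩ := hν (Multiplicative.ofAdd (d - pathDegree ν α (α x)))
  refine ⟨(FundamentalGroup.toPath g).trans (α x), ?_⟩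
  rw [pathDegree_trans, pathDegree_loop]
  have h : loopDegree ν (FundamentalGroup.toPath g) = d - pathDegree ν α (α x) :=
    congrArg Multiplicative.toAdd hg
  rw [h]
  ring

lemma mem_ker_reduction_iff (N : ℕ) (g : FundamentalGroup X x₀) :
    g ∈ (reduction ν N).ker ↔ ((loopDegree ν (FundamentalGroup.toPath g) : ℤ) : ZMod N) = 0 :=
  Iff.rfl

end Monodromy

/-! ### Levels in the fibers of the covering -/

section Covering

open Path

variable {X Y : Type*} [TopologicalSpace X] [TopologicalSpace Y] {q : C(Y, X)} {y₀ : Y}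
  (cov : IsCoveringMap q) (ν : FundamentalGroup X (q y₀) →* Multiplicative ℤ)
  (α : ∀ x, Homotopic.Quotient (q y₀) x) (N : ℕ)

lemma isCoveringMap_surjective_of_preconnectedSpace {X Y : Type*} [TopologicalSpace X]
    [TopologicalSpace Y] [PreconnectedSpace X] [Nonempty Y] {q : Y → X} (cov : IsCoveringMap q) :
    Function.Surjective q := by
  have hopen : IsOpen (Set.range q) := cov.isOpenMap.isOpen_range
  have hclosed : IsClosed (Set.range q) := by
    rw [← isOpen_compl_iff, isOpen_iff_mem_nhds]
    intro x hx
    obtain ⟨-, U, hxU, hU, -, H, hH⟩ := cov x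
    -- Over an evenly covered neighborhood, any point of `Y` yields a point in the fiber over `x`.
    -- An empty fiber therefore stays empty nearby.
    refine Filter.mem_of_superset (hU.mem_nhds hxU) ?_
    rintro _ hyU ⟨y, rfl⟩
    exact hx ⟨_, (H ⟨y, hyU⟩).2.2⟩
  exact Set.range_eq_univ.mp (IsClopen.eq_univ ⟨hclosed, hopen⟩ (Set.range_nonempty q))

variable (hrange : (FundamentalGroup.mapOfEq q (rfl : q y₀ = q y₀)).range = (reduction ν N).ker)

include hrange in
lemma loopDegree_map (γ : Homotopic.Quotient y₀ y₀) : ((loopDegree ν (γ.map q) : ℤ) : ZMod N) = 0 := by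
  refine (mem_ker_reduction_iff ν N (FundamentalGroup.fromPath (γ.map q))).mp ?_
  rw [← hrange]
  refine ⟨FundamentalGroup.fromPath γ, ?_⟩
  rw [FundamentalGroup.mapOfEq_apply]
  exact Homotopic.Quotient.cast_rfl_rfl _

lemma map_trans_quotient {x y z : Y} (γ : Homotopic.Quotient x y) (γ' : Homotopic.Quotient y z) :
    (γ.trans γ').map q = (γ.map q).trans (γ'.map q) := by
  induction γ, γ' using Homotopic.Quotient.ind₂ with | mk γ γ' =>
  exact congrArg Homotopic.Quotient.mk (Path.map_trans γ γ' q.continuous)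

lemma map_symm_quotient {x y : Y} (γ : Homotopic.Quotient x y) : γ.symm.map q = (γ.map q).symm := by
  induction γ using Homotopic.Quotient.ind with | mk γ =>
  rfl

-- Two paths with the same ends differ by a loop of `Y`, whose image has degree 0 modulo `N`. Hence
-- `fiberLevel` does not depend on the choice of `β`.
include hrange in
lemma pathDegree_map_congr {y : Y} (γ γ' : Homotopic.Quotient y₀ y) :
    ((pathDegree ν α (γ.map q) : ℤ) : ZMod N) = (pathDegree ν α (γ'.map q) : ℤ) := by
  have h := loopDegree_map ν N hrange (γ.trans γ'.symm)
  rw [← pathDegree_loop ν α, map_trans_quotient, pathDegree_trans, map_symm_quotient,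
    pathDegree_symm] at h
  push_cast at h
  linear_combination h

-- The loop formed by `γ` and the inverse of `γ'` has degree 0 modulo `N`, so it comes from a loop
-- at `y₀`. The lifts of the two paths then end at the same point.
include hrange in
lemma monodromy_eq_of_pathDegree_eq {x : X} (γ γ' : Homotopic.Quotient (q y₀) x)
    (h : ((pathDegree ν α γ : ℤ) : ZMod N) = (pathDegree ν α γ' : ℤ)) :
    cov.monodromy γ ⟨y₀, rfl⟩ = cov.monodromy γ' ⟨y₀, rfl⟩ := by
  have hmem : FundamentalGroup.fromPath (γ.trans γ'.symm) ∈ (reduction ν N).ker := by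
    rw [mem_ker_reduction_iff]
    change ((loopDegree ν (γ.trans γ'.symm) : ℤ) : ZMod N) = 0
    rw [← pathDegree_loop ν α, pathDegree_trans, pathDegree_symm]
    push_cast
    linear_combination h
  rw [← hrange] at hmem
  obtain ⟨c, hc⟩ := hmem
  rw [FundamentalGroup.mapOfEq_apply] at hc
  have hc' : (FundamentalGroup.toPath c).map q = γ.trans γ'.symm :=
    (Homotopic.Quotient.cast_rfl_rfl _).symm.trans hc
  have hγ : γ = ((FundamentalGroup.toPath c).map q).trans γ' := by
    rw [hc', Homotopic.Quotient.trans_assoc, Homotopic.Quotient.symm_trans, Homotopic.Quotient.trans_refl]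
  rw [hγ, cov.monodromy_trans_apply]
  congr 1
  exact cov.monodromy_map _

/-- The degree modulo `N` of a path from the base point. -/
def fiberLevel (β : ∀ y, Homotopic.Quotient y₀ y) (y : Y) : ZMod N :=
  (pathDegree ν α ((β y).map q) : ℤ)

include hrange in
lemma fiberLevel_monodromy (β : ∀ y, Homotopic.Quotient y₀ y) {x : X} (γ : Homotopic.Quotient (q y₀) x) :
    fiberLevel ν α N β (cov.monodromy γ ⟨y₀, rfl⟩) = (pathDegree ν α γ : ℤ) := by
  rw [fiberLevel, pathDegree_map_congr ν α N hrange _ (cov.liftPathQuotient γ ⟨y₀, rfl⟩)]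
  congr 1
  exact (congrArg (pathDegree ν α) (cov.map_liftPathQuotient γ ⟨y₀, rfl⟩)).trans
    (pathDegree_cast ν α _ _ _)

include cov hrange in
lemma fiberLevel_injective (β : ∀ y, Homotopic.Quotient y₀ y) {y y' : Y} (hy : q y = q y')
    (h : fiberLevel ν α N β y = fiberLevel ν α N β y') : y = y' := by
  -- The base point `x` is left free so that the equation defining the fiber can be substituted
  -- away.
  have key : ∀ {x : X} (e : q ⁻¹' {x}), ∃ γ : Homotopic.Quotient (q y₀) x,
      cov.monodromy γ ⟨y₀, rfl⟩ = e := by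
    rintro _ ⟨y, rfl⟩
    exact ⟨(β y).map q, cov.monodromy_map _⟩
  obtain ⟨γ, hγ⟩ := key (⟨y, hy⟩ : q ⁻¹' {q y'})
  obtain ⟨γ', hγ'⟩ := key (⟨y', rfl⟩ : q ⁻¹' {q y'})
  have h1 := fiberLevel_monodromy cov ν α N hrange β γ
  have h2 := fiberLevel_monodromy cov ν α N hrange β γ'
  rw [hγ] at h1
  rw [hγ'] at h2
  have := monodromy_eq_of_pathDegree_eq cov ν α N hrange γ γ' (by rw [← h1, ← h2, h])
  rw [hγ, hγ'] at this
  exact congrArg Subtype.val this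

include cov hrange in
lemma exists_fiberLevel (hν : Function.Surjective ν) (β : ∀ y, Homotopic.Quotient y₀ y) (x : X)
    (g : ZMod N) : ∃ y, q y = x ∧ fiberLevel ν α N β y = g := by
  obtain ⟨d, rfl⟩ := ZMod.intCast_surjective g
  obtain ⟨γ, hγ⟩ := exists_pathDegree_eq ν α hν x d
  exact ⟨_, (cov.monodromy γ ⟨y₀, rfl⟩).2, by rw [fiberLevel_monodromy cov ν α N hrange, hγ]⟩

include hrange in
lemma fiberLevel_path (β : ∀ y, Homotopic.Quotient y₀ y) {y y' : Y} (γ : Homotopic.Quotient y y') :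
    fiberLevel ν α N β y' = fiberLevel ν α N β y + (pathDegree ν α (γ.map q) : ℤ) := by
  rw [fiberLevel, pathDegree_map_congr ν α N hrange _ ((β y).trans γ), map_trans_quotient,
    pathDegree_trans, Int.cast_add]
  rfl

end Covering

/-! ### Singular simplices, their lifts, and paths -/

section Simplices

open CategoryTheory Simplicial Opposite TopCat

lemma Convex.locallyPathConnectedSpace {E : Type*} [SeminormedAddCommGroup E] [NormedSpace ℝ E]
    {s : Set E} (hs : Convex ℝ s) : LocallyPathConnectedSpace s := by
  refine LocallyPathConnectedSpace.of_bases (fun x ↦ Metric.nhds_basis_ball (x := x)) ?_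
  intro x ε hε
  rw [Topology.IsInducing.subtypeVal.isPathConnected_iff]
  have h : (Subtype.val '' Metric.ball x ε : Set E) = s ∩ Metric.ball x.1 ε := by
    ext y
    constructor
    · rintro ⟨y, hy, rfl⟩
      exact ⟨y.2, hy⟩
    · rintro ⟨hy, hy'⟩
      exact ⟨⟨y, hy⟩, hy', rfl⟩
  rw [h]
  exact (hs.inter (convex_ball _ _)).isPathConnected ⟨x, x.2, Metric.mem_ball_self hε⟩

instance (n : ℕ) : LocallyPathConnectedSpace (stdSimplex ℝ (Fin (n + 1))) :=
  Convex.locallyPathConnectedSpace (convex_stdSimplex ℝ _)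

instance (n : ℕ) : ContractibleSpace (stdSimplex ℝ (Fin (n + 1))) :=
  (convex_stdSimplex ℝ _).contractibleSpace ⟨_, single_mem_stdSimplex ℝ 0⟩

variable {X Y : Type u} [TopologicalSpace X] [TopologicalSpace Y]

/-- The singular simplicial set of a space. -/
abbrev sing (X : Type u) [TopologicalSpace X] : SSet.{u} := TopCat.toSSet.obj (TopCat.of X)

/-- A singular simplex as a continuous map. -/
def simplexMap {n : ℕ} : (sing X) _⦋n⦌ ≃ C(stdSimplex ℝ (Fin (n + 1)), X) :=
  toSSetObjEquiv (TopCat.of X) (op ⦋n⦌)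

/-- The point given by a singular `0`-simplex. -/
def simplexPoint : (sing X) _⦋0⦌ ≃ X := toSSetObj₀Equiv (X := TopCat.of X)

lemma simplexMap_δ {n : ℕ} (s : (sing X) _⦋n + 1⦌) (i : Fin (n + 2))
    (z : stdSimplex ℝ (Fin (n + 1))) :
    simplexMap ((sing X).δ i s) z = simplexMap s (stdSimplex.map i.succAbove z) := rfl

lemma default_eq_vertex : (default : stdSimplex ℝ (Fin (⦋0⦌.len + 1))) =
    (stdSimplex.vertex (0 : Fin 1) : stdSimplex ℝ (Fin 1)) := Subsingleton.elim _ _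

lemma simplexPoint_δ (s : (sing X) _⦋1⦌) (i : Fin 2) :
    simplexPoint ((sing X).δ i s) = simplexMap s (stdSimplex.vertex (i.succAbove 0)) := by
  change simplexMap s (stdSimplex.map i.succAbove default) = _
  rw [default_eq_vertex, stdSimplex.map_vertex]

lemma simplexPoint_initialVertex {n : ℕ} (s : (sing X) _⦋n⦌) :
    simplexPoint (initialVertex s) = simplexMap s (stdSimplex.vertex 0) := by
  change simplexMap s (stdSimplex.map (fun _ ↦ 0) default) = _
  rw [default_eq_vertex, stdSimplex.map_vertex]

/-- The map of singular simplicial sets induced by a continuous map. -/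
def singMap (q : C(Y, X)) : sing Y ⟶ sing X := TopCat.toSSet.map (TopCat.ofHom q)

lemma simplexMap_singMap (q : C(Y, X)) {n : ℕ} (s : (sing Y) _⦋n⦌) :
    simplexMap ((singMap q).app _ s) = q.comp (simplexMap s) := rfl

/-- The simplex is contractible and locally path connected, so a map out of it lifts uniquely once
the lift of one vertex is prescribed. -/
lemma exists_lift_simplex {q : C(Y, X)} (cov : IsCoveringMap q) {n : ℕ} (s : (sing X) _⦋n⦌)
    (y : Y) (hy : q y = simplexMap s (stdSimplex.vertex 0)) :
    ∃! t : (sing Y) _⦋n⦌, simplexMap t (stdSimplex.vertex 0) = y ∧ (singMap q).app _ t = s := by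
  obtain ⟨F, ⟨hF1, hF2⟩, hF⟩ :=
    cov.existsUnique_continuousMap_lifts (simplexMap s) (stdSimplex.vertex 0) y hy
  refine ⟨simplexMap.symm F, ⟨?_, ?_⟩, ?_⟩
  · simpa using hF1
  · apply simplexMap.injective
    rw [simplexMap_singMap, Equiv.apply_symm_apply]
    exact DFunLike.coe_injective hF2
  · rintro t ⟨ht1, rfl⟩
    rw [← hF (simplexMap t) ⟨ht1, rfl⟩, Equiv.symm_apply_apply]

/-- A singular `1`-simplex as a path. -/
def simplexPath (s : (sing X) _⦋1⦌) :
    Path (simplexPoint ((sing X).δ 1 s)) (simplexPoint ((sing X).δ 0 s)) where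
  toFun t := simplexMap s (stdSimplexHomeomorphUnitInterval.symm t)
  continuous_toFun := by fun_prop
  source' := by
    rw [simplexPoint_δ]
    congr 1
    rw [Homeomorph.symm_apply_eq]
    rfl
  target' := by
    rw [simplexPoint_δ]
    congr 1
    rw [Homeomorph.symm_apply_eq]
    rfl

lemma pathSimplex_simplexPath (s : (sing X) _⦋1⦌) : pathSimplex (simplexPath s) = s := by
  apply simplexMap.injective
  refine (Equiv.apply_symm_apply _ _).trans (ContinuousMap.ext fun z ↦ ?_)
  exact congrArg (simplexMap s) (Homeomorph.symm_apply_apply _ z)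

lemma simplexMap_pathSimplex {x y : X} (γ : Path x y) (z : stdSimplex ℝ (Fin 2)) :
    simplexMap (pathSimplex γ) z = γ (stdSimplexHomeomorphUnitInterval z) := rfl

/-- The affine map of the triangle to the interval with values `0`, `1 / 2`, `1` at the
vertices. -/
def triangleToInterval : C(stdSimplex ℝ (Fin 3), unitInterval) where
  -- The values match the breakpoint of `Path.trans`, so the faces of `transSimplex` are exactly
  -- `γ'`, `γ.trans γ'` and `γ`, with no reparametrization.
  toFun z := ⟨z 1 / 2 + z 2, by
    have h0 := stdSimplex.zero_le z 0
    have h1 := stdSimplex.zero_le z 1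
    have h2 := stdSimplex.zero_le z 2
    have h := stdSimplex.sum_eq_one z
    rw [Fin.sum_univ_three] at h
    constructor <;> linarith⟩
  continuous_toFun := by
    refine Continuous.subtype_mk ?_ _
    exact (((continuous_apply 1).comp continuous_subtype_val).div_const 2).add
      ((continuous_apply 2).comp continuous_subtype_val)

/-- The triangle that witnesses the concatenation of two paths. -/
def transSimplex {x y z : X} (γ : Path x y) (γ' : Path y z) : (sing X) _⦋2⦌ :=
  simplexMap.symm ((γ.trans γ').toContinuousMap.comp triangleToInterval)

lemma simplexMap_transSimplex {x y z : X} (γ : Path x y) (γ' : Path y z)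
    (w : stdSimplex ℝ (Fin 3)) :
    simplexMap (transSimplex γ γ') w = (γ.trans γ') (triangleToInterval w) := rfl

lemma triangleToInterval_map (i : Fin 3) (w : stdSimplex ℝ (Fin 2)) :
    (triangleToInterval (stdSimplex.map i.succAbove w) : ℝ) =
      if i = 0 then w 0 / 2 + w 1 else if i = 1 then w 1 else w 1 / 2 := by
  change FunOnFinite.linearMap ℝ ℝ i.succAbove w 1 / 2 +
    FunOnFinite.linearMap ℝ ℝ i.succAbove w 2 = _
  simp only [FunOnFinite.linearMap_apply_apply, Finset.sum_filter, Fin.sum_univ_two]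
  fin_cases i <;> simp [Fin.succAbove, Fin.ext_iff, Fin.lt_def]

lemma δ_zero_transSimplex {x y z : X} (γ : Path x y) (γ' : Path y z) :
    (sing X).δ 0 (transSimplex γ γ') = pathSimplex γ' := by
  refine simplexMap.injective (ContinuousMap.ext fun w ↦ ?_)
  rw [simplexMap_δ, simplexMap_transSimplex, simplexMap_pathSimplex, Path.trans_apply]
  have h := triangleToInterval_map 0 w
  have hw := stdSimplex.add_eq_one w
  have hw1 := stdSimplex.zero_le w 1
  rw [if_pos rfl] at h
  split_ifs with h'
  · have h1 : w 1 = 0 := by linarith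
    trans y
    · convert γ.target using 2
      apply Subtype.ext
      change 2 * (triangleToInterval _ : ℝ) = 1
      rw [h]
      linarith
    · convert γ'.source.symm using 2
      exact Subtype.ext h1
  · congr 1
    apply Subtype.ext
    change 2 * (triangleToInterval _ : ℝ) - 1 = w 1
    rw [h]
    linarith

lemma δ_one_transSimplex {x y z : X} (γ : Path x y) (γ' : Path y z) :
    (sing X).δ 1 (transSimplex γ γ') = pathSimplex (γ.trans γ') := by
  refine simplexMap.injective (ContinuousMap.ext fun w ↦ ?_)
  rw [simplexMap_δ, simplexMap_transSimplex, simplexMap_pathSimplex]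
  congr 1
  exact Subtype.ext (triangleToInterval_map 1 w)

lemma δ_two_transSimplex {x y z : X} (γ : Path x y) (γ' : Path y z) :
    (sing X).δ 2 (transSimplex γ γ') = pathSimplex γ := by
  refine simplexMap.injective (ContinuousMap.ext fun w ↦ ?_)
  rw [simplexMap_δ, simplexMap_transSimplex, simplexMap_pathSimplex, Path.trans_apply]
  have h : (triangleToInterval (stdSimplex.map (Fin.succAbove 2) w) : ℝ) = w 1 / 2 :=
    triangleToInterval_map 2 w
  have hw1 := stdSimplex.le_one w 1
  rw [dif_pos (by rw [h]; linarith)]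
  congr 1
  apply Subtype.ext
  change 2 * (triangleToInterval _ : ℝ) = w 1
  rw [h]
  ring

lemma cocycle_trans {K : Type} [Field K] (η : SingularOneCocycle K X) {x y z : X} (γ : Path x y)
    (γ' : Path y z) :
    η.1 (pathSimplex (γ.trans γ')) = η.1 (pathSimplex γ) + η.1 (pathSimplex γ') := by
  have h := congrFun (LinearMap.mem_ker.mp η.2) (transSimplex γ γ')
  rw [coboundary_apply, Fin.sum_univ_three] at h
  rw [← δ_zero_transSimplex γ γ', ← δ_one_transSimplex γ γ', ← δ_two_transSimplex γ γ']
  simp only [Fin.val_zero, Fin.val_one, Fin.val_two, Pi.zero_apply] at h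
  linear_combination -h

end Simplices

/-! ### The cyclic covering adapted to the cocycle -/

section Main

open CategoryTheory Simplicial Path

variable {X : Type u} [TopologicalSpace X]

/-- A cocycle that represents `ν` agrees with the extension of `ν` to paths, up to the coboundary
of a function. -/
lemma exists_cocycle_eq {K : Type} [Field K] {x₀ : X}
    (ν : FundamentalGroup X x₀ →* Multiplicative ℤ) [PathConnectedSpace X]
    (α : ∀ x, Homotopic.Quotient x₀ x)
    (η : SingularOneCocycle K X) (hη : Represents η ν) :
    ∃ f : X → K, ∀ {x y : X} (γ : Path x y),
      η.1 (pathSimplex γ) = (pathDegree ν α (.mk γ) : ℤ) + f y - f x := by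
  -- The difference `e` is additive under concatenation and vanishes on loops at `x₀`. Its values on
  -- paths from `x₀` then serve as a potential; homotopy invariance of `η` on arbitrary paths is not
  -- needed.
  let e {x y : X} (γ : Path x y) : K := η.1 (pathSimplex γ) - (pathDegree ν α (.mk γ) : ℤ)
  have he : ∀ {x y z : X} (γ : Path x y) (γ' : Path y z), e (γ.trans γ') = e γ + e γ' := by
    intro x y z γ γ'
    simp only [e, cocycle_trans, Homotopic.Quotient.mk_trans, pathDegree_trans]
    push_cast
    ring
  have he0 : ∀ γ : Path x₀ x₀, e γ = 0 := fun γ ↦ by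
    simp only [e]
    rw [hη γ, pathDegree_loop]
    exact sub_self _
  let σ := PathConnectedSpace.somePath x₀
  refine ⟨fun x ↦ e (σ x), fun {x y} γ ↦ ?_⟩
  have h1 := he0 ((σ x).trans (γ.trans (σ y).symm))
  have h2 := he0 ((σ y).trans (σ y).symm)
  rw [he, he] at h1
  rw [he] at h2
  have h3 : η.1 (pathSimplex γ) = e γ + (pathDegree ν α (.mk γ) : ℤ) := by simp [e]
  rw [h3]
  linear_combination h1 - h2

theorem exists_cyclicCover {Y : Type u} [TopologicalSpace Y] {q : C(Y, X)} {y₀ : Y}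
    [PathConnectedSpace X] [PathConnectedSpace Y] (cov : IsCoveringMap q)
    (ν : FundamentalGroup X (q y₀) →* Multiplicative ℤ) (hν : Function.Surjective ν)
    (N : ℕ) (hrange : (FundamentalGroup.mapOfEq q (rfl : q y₀ = q y₀)).range = (reduction ν N).ker)
    {K : Type} [Field K] (φ : ZMod N →+* K) (hφ : Function.Surjective φ)
    (η : SingularOneCocycle K X) (hη : Represents η ν) :
    ∃ C : CyclicCover N (sing Y) (sing X), ∀ x, η.1 x = φ (C.jump x) := by
  let α (x : X) : Homotopic.Quotient (q y₀) x := .mk (PathConnectedSpace.somePath _ _)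
  let β (y : Y) : Homotopic.Quotient y₀ y := .mk (PathConnectedSpace.somePath _ _)
  obtain ⟨f, hf⟩ := exists_cocycle_eq ν α η hη
  -- The correction `f` takes values in `K`, while levels live in `ZMod N`. Adding a lift of `f` to
  -- the levels turns the jumps into lifts of `η` on the nose, and on each fiber it is only a
  -- translation.
  choose F hF using fun x ↦ hφ (f x)
  refine ⟨{
    π := singMap q
    level s := fiberLevel ν α N β (simplexPoint s) + F (q (simplexPoint s))
    jump s := (pathDegree ν α (.mk (simplexPath s)) : ℤ) +
      F (simplexPoint ((sing X).δ 0 s)) - F (simplexPoint ((sing X).δ 1 s))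
    level_edge s := ?_
    bijective n := ⟨?_, ?_⟩ }, fun s ↦ ?_⟩
  · rw [fiberLevel_path ν α N hrange β (.mk (simplexPath s))]
    have h1 : pathDegree ν α ((Homotopic.Quotient.mk (simplexPath s)).map q) =
        pathDegree ν α (.mk (simplexPath ((singMap q).app _ s))) := rfl
    have h2 : ∀ i, F (simplexPoint ((sing X).δ i ((singMap q).app _ s))) =
        F (q (simplexPoint ((sing Y).δ i s))) := fun _ ↦ rfl
    rw [h1, h2, h2]
    ring
  · intro s t hst
    obtain ⟨h1, h2⟩ := Prod.ext_iff.mp hst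
    dsimp only at h1 h2
    rw [simplexPoint_initialVertex, simplexPoint_initialVertex] at h2
    have h3 : q (simplexMap s (stdSimplex.vertex 0)) = q (simplexMap t (stdSimplex.vertex 0)) :=
      congrArg (fun s ↦ simplexMap s (stdSimplex.vertex 0)) h1
    rw [h3, add_left_inj] at h2
    have h4 := fiberLevel_injective cov ν α N hrange β h3 h2
    exact (exists_lift_simplex cov ((singMap q).app _ s) _ rfl).unique ⟨rfl, rfl⟩ ⟨h4.symm, h1.symm⟩
  · rintro ⟨s, g⟩
    obtain ⟨y, hy, hg⟩ := exists_fiberLevel cov ν α N hrange hν β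
      (simplexMap s (stdSimplex.vertex 0)) (g - F (simplexMap s (stdSimplex.vertex 0)))
    obtain ⟨t, ⟨ht, hts⟩, -⟩ := exists_lift_simplex cov s y hy
    refine ⟨t, Prod.ext hts ?_⟩
    dsimp only
    rw [simplexPoint_initialVertex, ht, hg, hy, sub_add_cancel]
  · have h := hf (simplexPath s)
    rw [pathSimplex_simplexPath] at h
    rw [h, map_sub, map_add, map_intCast, hF, hF]

end Main

end AomotoCover

end

theorem proposition1p3
    {X : Type u} [TopologicalSpace X] [T2Space X] [ConnectedSpace X]
    [Topology.CWComplex (Set.univ : Set X)] [Topology.CWComplex.Finite (Set.univ : Set X)]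
    {x₀ : X} (ν : FundamentalGroup X x₀ →* Multiplicative ℤ) (hν : Function.Surjective ν)
    (p : ℕ) [Fact p.Prime] (r : ℕ) (hr : 0 < r)
    {Xr : Type u} [TopologicalSpace Xr] {y₀ : Xr} (q : C(Xr, X)) (hq : q y₀ = x₀)
    (hcover : AomotoCover.IsCoverOf (AomotoCover.reduction ν (p ^ r)).ker q hq)
    (η : AomotoCover.SingularOneCocycle (ZMod p) X) (hη : AomotoCover.Represents η ν) (i : ℕ) :
    AomotoCover.betti (ZMod p) Xr i ≤
      AomotoCover.betti (ZMod p) X i +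
        ((p ^ r - 1 : ℕ) : ℕ∞) * AomotoCover.aomotoBetti η i := by
  subst hq
  have cov := hcover.isCoveringMap
  have : PathConnectedSpace Xr := hcover.pathConnectedSpace
  have : PathConnectedSpace X :=
    (AomotoCover.isCoveringMap_surjective_of_preconnectedSpace cov).pathConnectedSpace q.continuous
  -- Since `r` is positive, `p` divides `p ^ r`, and levels modulo `p ^ r` reduce to `ZMod p`.
  obtain ⟨C, hC⟩ := AomotoCover.exists_cyclicCover cov ν hν (p ^ r) hcover.range_eq
    (ZMod.castHom (dvd_pow_self p hr.ne') (ZMod p)) (ZMod.castHom_surjective _) η hη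
  rw [AomotoCover.betti_eq, AomotoCover.betti_eq]
  exact C.toENat_rank_cohomology_le (ZMod p) p r _ η hC i
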